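/- Let $m\in\{2,3\}$, $n\ge 2$, and let $\mathbb G$ be a graph on $\{1,\dots,n\}$ with edges $\mathcal E_k=(\mathcal E_k^{\rm tail},\mathcal E_k^{\rm head})$, $k=1,\dots,|\mathcal E|$ (each undirected edge listed once, arbitrarily oriented), with incidence matrix $B$ ($+1$ at the tail and $-1$ at the head of each edge). Write $\overline M=M\otimes I_m$, let $D_x$ be the block-diagonal matrix with the blocks $x_k\in\mathbb R^m$ of a stacked vector $x$ on its diagonal, and $z=\overline B^Tp$ for stacked positions $p\in\mathbb R^{mn}$. Let $p^*$ be a configuration with $z^*=\overline B^Tp^*$ such that the framework $(\mathbb G,p^*)$ is infinitesimally and minimally rigid: $\operatorname{rank}(D_{z^*}^T\overline B^T)=|\mathcal E|$, which equals $2n-3$ if $m=2$ and $3n-6$ if $m=3$. Let $\mathcal Z=\{(I_{|\mathcal E|}\otimes R)z^*: R\in SO(m)\}$ and $e_k=\|z_k\|^2-\|z_k^*\|^2$. For $\theta=(\mu,\tilde\mu)\in\mathbb R^{2|\mathcal E|}$ let $A_v=A_v(\mu,\tilde\mu)$ be the $n\times|\mathcal E|$ matrix with $(i,k)$ entry $\mu_k$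 if $i=\mathcal E_k^{\rm tail}$, $\tilde\mu_k$ if $i=\mathcal E_k^{\rm head}$ and $0$ otherwise, let $T(z^*)$ be the matrix with $T(z^*)\theta=\overline A_v(\theta)z^*$, and put $A_a=A_vB^TA_v$ and $A=c_1A_v+A_a$. Call $\theta$ designed for the shape if $\theta=\theta_v+\theta_\omega$ with $\theta_v\in\hat{\mathcal U}$, the orthogonal projection of $\operatorname{Ker}(\overline B^TT(z^*))$ onto $\operatorname{Ker}(T(z^*))^\perp$ (translations), and $\theta_\omega\in\hat{\mathcal W}$, the orthogonal projection of $\operatorname{Ker}(D_{z^*}^T\overline B^TT(z^*))$ onto $\hat{\mathcal U}^\perp$ (rotations). Consider the closed loop $$\dot p=v,\qquad \dot v=u=-c_1v-c_2\overline BD_ze+\overline A(\mu,\tilde\mu)z,$$ and the velocity error $e_v=v-\overline A_v(\mu,\tilde\mu)z$. Then there are constants $\rho,\rho_\mu,\epsilon,c_1,c_2>0$ such that for every designed $\theta=(\mu,\tilde\mu)$ with $\|\theta\|\le\rho_\mu$ the origin $e=0$, $e_v=0$ of the errors corresponding to $z\in\mathcal Z$ is exponentially stable in $$\mathcal Q=\Big\{(e,e_v):\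 \tfrac{\epsilon c_1+c_2}{4}\|e\|^2+\tfrac12\|e_v\|^2\le\rho\Big\}.$$ That is, let $\mathcal S$ be the set of states $(p,v)$ that can be joined, by a continuous path of states whose errors all lie in $\mathcal Q$, to a state with $z\in\mathcal Z$ and $e_v=0$. From every state in $\mathcal S$ there is a solution for all $t\ge0$, and there are $K,\gamma>0$ such that every solution starting in $\mathcal S$ satisfies $\|e(t)\|+\|e_v(t)\|\le Ke^{-\gamma t}(\|e(0)\|+\|e_v(0)\|)$ for all $t\ge 0$. In particular, for every solution starting in $\mathcal S$ the shape converges to the undistorted desired one and the velocities converge to the prescribed collective motion: there is a curve $z^*(t)\in\mathcal Z$, $t\ge0$, with $\dot z^*(t)=\overline B^Tv^*(t)$ where $v^*(t)=\overline A_vz^*(t)$, such that $z(t)-z^*(t)\to0$ and $v(t)-v^*(t)\to0$ as $t\to\infty$. -/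

import Mathlib

open Matrix Filter Topology
open scoped Kronecker

namespace Formation

/-- A sensing graph on the agents `Fin n` with `l` enumerated edges. Edge `k` joins the two
distinct agents `tail k` and `head k`; each undirected edge is listed once, with an arbitrary
orientation. -/
structure SensingGraph (n l : ℕ) where
  tail : Fin l → Fin n
  head : Fin l → Fin n
  tail_ne_head : ∀ k, tail k ≠ head k
  edge_injective : Function.Injective fun k => s(tail k, head k)

/-- Stacked vectors `col(x₁, …, x_N)` with blocks `xᵢ ∈ ℝᵐ`, with the Euclidean norm;
the entry `(i, a)` is the `a`-th coordinate of `xᵢ`. -/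
abbrev Stack (N m : ℕ) := EuclideanSpace ℝ (Fin N × Fin m)

/-- The pair `[μ; μ̃]` of motion parameters: `inl k` is `μ_k`, `inr k` is `μ̃_k`. -/
abbrev Params (l : ℕ) := EuclideanSpace ℝ (Fin l ⊕ Fin l)

/-- Matrix-vector product between Euclidean spaces. -/
noncomputable abbrev app {ι κ : Type} [Fintype ι] [DecidableEq ι] [Fintype κ]
    (M : Matrix κ ι ℝ) (x : EuclideanSpace ℝ ι) : EuclideanSpace ℝ κ :=
  Matrix.toEuclideanLin M x

/-- The `i`-th block of a stacked vector. -/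
noncomputable def block {N m : ℕ} (x : Stack N m) (i : Fin N) : EuclideanSpace ℝ (Fin m) :=
  WithLp.toLp 2 fun a => x (i, a)

/-- `A ⊗ I_m`. -/
def bar (m : ℕ) {N M : ℕ} (A : Matrix (Fin N) (Fin M) ℝ) :
    Matrix (Fin N × Fin m) (Fin M × Fin m) ℝ :=
  A ⊗ₖ (1 : Matrix (Fin m) (Fin m) ℝ)

/-- The block diagonal matrix `D_x = diag(x₁, …, x_N)`, of size `Nm × N`. -/
def D {N m : ℕ} (x : Stack N m) : Matrix (Fin N × Fin m) (Fin N) ℝ :=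
  Matrix.of fun i j => if i.1 = j then x i else 0

namespace SensingGraph

variable {n l : ℕ} (G : SensingGraph n l)

/-- Incidence matrix: `+1` at the tail, `-1` at the head of an edge. -/
def B : Matrix (Fin n) (Fin l) ℝ :=
  Matrix.of fun i k => if i = G.tail k then 1 else if i = G.head k then -1 else 0

/-- Indicator matrix of the tails. -/
def S₁ : Matrix (Fin n) (Fin l) ℝ :=
  Matrix.of fun i k => if i = G.tail k then 1 else 0

/-- Indicator matrix of the heads. -/
def S₂ : Matrix (Fin n) (Fin l) ℝ :=
  Matrix.of fun i k => if i = G.head k then 1 else 0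

/-- The relative positions `z = B̄ᵀ p`. -/
noncomputable def rel {m : ℕ} (p : Stack n m) : Stack l m := app (bar m G.B)ᵀ p

/-- The rigidity matrix `R(z) = D_zᵀ B̄ᵀ`. -/
def rigidityMatrix {m : ℕ} (z : Stack l m) : Matrix (Fin l) (Fin n × Fin m) ℝ :=
  (D z)ᵀ * (bar m G.B)ᵀ

/-- Infinitesimal rigidity of the framework `(G, p)`: the rigidity matrix has rank `2n - 3` in the
plane and `3n - 6` in space. -/
def InfinitesimallyRigid {m : ℕ} (p : Stack n m) : Prop :=
  (m = 2 ∧ (G.rigidityMatrix (G.rel p)).rank + 3 = 2 * n) ∨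
  (m = 3 ∧ (G.rigidityMatrix (G.rel p)).rank + 6 = 3 * n)

/-- Infinitesimally and minimally rigid: moreover the number of edges is `2n - 3` in the plane and
`3n - 6` in space. -/
def InfMinRigid {m : ℕ} (p : Stack n m) : Prop :=
  G.InfinitesimallyRigid p ∧ ((m = 2 ∧ l + 3 = 2 * n) ∨ (m = 3 ∧ l + 6 = 3 * n))

/-- The matrix of distributed motion parameters: `μ_k` at the tail and `μ̃_k` at the head of
edge `k`. It is the matrix `A_v(μ, μ̃)` prescribing the collective velocity. -/
def Av (θ : Params l) : Matrix (Fin n) (Fin l) ℝ :=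
  Matrix.of fun i k =>
    if i = G.tail k then θ (Sum.inl k) else if i = G.head k then θ (Sum.inr k) else 0

/-- The matrix `A_a = A_v Bᵀ A_v` of the collective acceleration. -/
def Aa (θ : Params l) : Matrix (Fin n) (Fin l) ℝ := G.Av θ * G.Bᵀ * G.Av θ

/-- `A(μ, μ̃) = c₁ A_v + A_a`. -/
def A (c₁ : ℝ) (θ : Params l) : Matrix (Fin n) (Fin l) ℝ := c₁ • G.Av θ + G.Aa θ

/-- `T(z) = [S̄₁ D_z  S̄₂ D_z]`, so that `T(z) [μ; μ̃] = Ā_v(μ, μ̃) z`. -/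
def T {m : ℕ} (z : Stack l m) : Matrix (Fin n × Fin m) (Fin l ⊕ Fin l) ℝ :=
  Matrix.fromCols (bar m G.S₁ * D z) (bar m G.S₂ * D z)

/-- Parameters of translations: the projection of `Ker (B̄ᵀ T(z))` onto `(Ker T(z))ᗮ`. -/
noncomputable def paramsU {m : ℕ} (z : Stack l m) : Submodule ℝ (Params l) :=
  (LinearMap.ker (toEuclideanLin ((bar m G.B)ᵀ * G.T z))).map
    ((LinearMap.ker (toEuclideanLin (G.T z)))ᗮ.starProjection : Params l →ₗ[ℝ] Params l)

/-- Parameters of rotations: the projection of `Ker (D_zᵀ B̄ᵀ T(z))` onto the orthogonal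
complement of the parameters of translations. -/
noncomputable def paramsW {m : ℕ} (z : Stack l m) : Submodule ℝ (Params l) :=
  (LinearMap.ker (toEuclideanLin ((D z)ᵀ * (bar m G.B)ᵀ * G.T z))).map
    ((G.paramsU z)ᗮ.starProjection : Params l →ₗ[ℝ] Params l)

/-- `θ = [μ; μ̃]` is a vector of motion parameters designed for the shape `z`: a sum of parameters
of a translation and parameters of a rotation. -/
def IsDesigned {m : ℕ} (z : Stack l m) (θ : Params l) : Prop :=
  ∃ θv ∈ G.paramsU z, ∃ θw ∈ G.paramsW z, θ = θv + θw

end SensingGraph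

/-- The set `𝒵` of all stacked vectors obtained from `zs` by a common rotation of its blocks. -/
def shapeSet {l m : ℕ} (zs : Stack l m) : Set (Stack l m) :=
  {z | ∃ R ∈ Matrix.specialOrthogonalGroup (Fin m) ℝ,
    z = app ((1 : Matrix (Fin l) (Fin l) ℝ) ⊗ₖ R) zs}

/-- The distance errors `e_k = ‖z_k‖² - d_k²`, with `d_k = ‖z_k^*‖`. -/
noncomputable def distError {l m : ℕ} (zs z : Stack l m) : EuclideanSpace ℝ (Fin l) :=
  WithLp.toLp 2 fun k => ‖block z k‖ ^ 2 - ‖block zs k‖ ^ 2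

namespace SensingGraph

variable {n l m : ℕ} (G : SensingGraph n l)

/-- The velocity error `e_v = v - Ā_v(μ, μ̃) z`. -/
noncomputable def velError (θ : Params l) (p v : Stack n m) : Stack n m :=
  v - app (bar m (G.Av θ)) (G.rel p)

/-- The control law `u = -c₁ v - c₂ B̄ D_z e + Ā(μ, μ̃) z`. -/
noncomputable def control (zs : Stack l m) (c₁ c₂ : ℝ) (θ : Params l) (p v : Stack n m) :
    Stack n m :=
  -(c₁ • v) - c₂ • app (bar m G.B * D (G.rel p)) (distError zs (G.rel p))
    + app (bar m (G.A c₁ θ)) (G.rel p)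

/-- `(p, v)` solves the closed loop `ṗ = v`, `v̇ = u` on `[0, ∞)`. -/
def IsSolution (zs : Stack l m) (c₁ c₂ : ℝ) (θ : Params l) (p v : ℝ → Stack n m) : Prop :=
  ∀ t, 0 ≤ t →
    HasDerivWithinAt p (v t) (Set.Ici 0) t ∧
    HasDerivWithinAt v (G.control zs c₁ c₂ θ (p t) (v t)) (Set.Ici 0) t

end SensingGraph

/-- The compact set `𝒬 = {(e, e_v) : (ε c₁ + c₂)/4 ‖e‖² + 1/2 ‖e_v‖² ≤ ρ}`. -/
def setQ (n l m : ℕ) (ρ ε c₁ c₂ : ℝ) : Set (EuclideanSpace ℝ (Fin l) × Stack n m) :=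
  {q | (ε * c₁ + c₂) / 4 * ‖q.1‖ ^ 2 + 1 / 2 * ‖q.2‖ ^ 2 ≤ ρ}

namespace SensingGraph

variable {n l m : ℕ} (G : SensingGraph n l)

/-- The states `(p, v)` whose errors lie in `𝒬`. -/
def statesQ (zs : Stack l m) (ρ ε c₁ c₂ : ℝ) (θ : Params l) : Set (Stack n m × Stack n m) :=
  {x | (distError zs (G.rel x.1), G.velError θ x.1 x.2) ∈ setQ n l m ρ ε c₁ c₂}

/-- The states in `𝒬` that belong to the origin `e = 0`, `e_v = 0` with `z ∈ 𝒵`: those joined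
inside `𝒬` to a state with `z ∈ 𝒵` and `e_v = 0`. (Vanishing of `e` alone does not force
`z ∈ 𝒵`: reflected and other non-congruent realizations of the same lengths have `e = 0`.) -/
def region (zs : Stack l m) (ρ ε c₁ c₂ : ℝ) (θ : Params l) : Set (Stack n m × Stack n m) :=
  {x | ∃ y : Stack n m × Stack n m, G.rel y.1 ∈ shapeSet zs ∧ G.velError θ y.1 y.2 = 0 ∧
    JoinedIn (G.statesQ zs ρ ε c₁ c₂ θ) y x}

/-- Exponential stability of the origin of the errors `(e, e_v)` with region of attraction
containing `S`: from every initial state in `S` the closed loop has a solution for all `t ≥ 0`,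
and along all these solutions the errors decay exponentially, with uniform constants. -/
def ErrorExpStableOn (zs : Stack l m) (c₁ c₂ : ℝ) (θ : Params l)
    (S : Set (Stack n m × Stack n m)) : Prop :=
  (∀ x ∈ S, ∃ p v : ℝ → Stack n m, G.IsSolution zs c₁ c₂ θ p v ∧ p 0 = x.1 ∧ v 0 = x.2) ∧
  ∃ K > 0, ∃ γ > 0, ∀ p v : ℝ → Stack n m, G.IsSolution zs c₁ c₂ θ p v → (p 0, v 0) ∈ S →
    ∀ t, 0 ≤ t →
      ‖distError zs (G.rel (p t))‖ + ‖G.velError θ (p t) (v t)‖ ≤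
        K * Real.exp (-γ * t) *
          (‖distError zs (G.rel (p 0))‖ + ‖G.velError θ (p 0) (v 0)‖)

/-- The shape and the velocities of `(p, v)` converge to the collective motion
`v^*(t) = Ā_v z^*(t)` of the desired shape: `z^*(t) ∈ 𝒵` moves with these velocities,
`ż^* = B̄ᵀ v^*`, and `z - z^* → 0`, `v - v^* → 0`. -/
def ConvergesToMotion (zs : Stack l m) (θ : Params l) (p v : ℝ → Stack n m) : Prop :=
  ∃ zt : ℝ → Stack l m,
    (∀ t, 0 ≤ t → zt t ∈ shapeSet zs ∧
      HasDerivWithinAt zt (G.rel (app (bar m (G.Av θ)) (zt t))) (Set.Ici 0) t) ∧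
    Tendsto (fun t => G.rel (p t) - zt t) atTop (𝓝 0) ∧
    Tendsto (fun t => v t - app (bar m (G.Av θ)) (zt t)) atTop (𝓝 0)

end SensingGraph

end Formation

/-! Both gains are taken equal to one, and the loop is rewritten with three objects: the
relative-position map `P`, the bilinear form `β` of blockwise inner products, and the velocity map
`N`. With z = P p, e = β(z, z) - e₀, R(z) = β(z, P ·) and w = v - N z, the error equations are e' =
2 R(z)(w + N z) and w' = -w - R(z)† e - N P w.

The obvious energy, a combination of ‖e‖² and ‖w‖², dissipates only w. The cross term ε⟨e, R(z) w⟩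
adds -ε‖R(z)† e‖², and R(z)† is bounded below on the shape set because the rigidity matrix has full
row rank (`InfMinRigid.exists_coercive`). Every other term is small: ε is small against the
constants of the problem, ‖N‖ is small against ε, and the drift R(z) N z vanishes on the shape set
for designed parameters (`isDesigned_tangent`), so near it the drift is O(‖N‖ ‖e‖).

These estimates need z near the shape set. `InfMinRigid.exists_near` supplies a local error bound,
distance ≤ C‖e‖, since infinitesimal rigidity leaves only rotations in the kernel of the linearized
lengths. Hence closeness improves itself while e is small. The continuity argument `le_of_bootstrap`
exploits this three times: along solutions (`exists_uniform_decay`), along the path defining the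
region (`infDist_le_of_mem_region`), and for global existence through a cutoff
(`exists_solution_of_apriori_bound`).

For the limiting motion, z' = P N z + P w with w decaying exponentially. The linear flow of P N
preserves the shape set, because P N commutes with rotations and acts on the desired shape as a skew
matrix (`InfMinRigid.exists_skew`, `exp_mem_shapeSet`). As the decay beats the expansion of this
flow, z is asymptotic to one of its orbits (`exists_asymptotic_orbit`). -/

namespace Formation

/-! ### Continuity arguments and global existence for ordinary differential equations -/

/-- A continuous function on `[0, T]` which starts below `a < b`, and is below `a` at every time up
to which it is below `b`, stays below `a`. -/
theorem le_of_bootstrap {g : ℝ → ℝ} {T a b : ℝ} (hab : a < b) (hg : ContinuousOn g (Set.Icc 0 T))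
    (h0 : g 0 ≤ b)
    (h : ∀ t ∈ Set.Icc 0 T, (∀ s ∈ Set.Icc 0 t, g s ≤ b) → g t ≤ a) :
    ∀ t ∈ Set.Icc 0 T, g t ≤ a := by
  -- Continuous induction: the set of times up to which `b` bounds `g` is closed, and the gap `a <
  -- b` lets it be extended to the right.
  have key : Set.Icc 0 T ⊆ {t | ∀ s ∈ Set.Icc 0 t, g s ≤ b} := by
    by_cases hT : 0 ≤ T
    swap
    · rw [Set.Icc_eq_empty hT]; exact Set.empty_subset _
    have hcl : IsClosed ({t | ∀ s ∈ Set.Icc 0 t, g s ≤ b} ∩ Set.Icc 0 T) := by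
      rw [← isOpen_compl_iff, isOpen_iff_mem_nhds]
      intro t ht
      by_cases htT : t ∈ Set.Icc 0 T
      swap
      · filter_upwards [isClosed_Icc.isOpen_compl.mem_nhds htT] with x hx hx'
        exact hx hx'.2
      have : ∃ s ∈ Set.Icc 0 t, b < g s := by
        by_contra! hcon
        exact ht ⟨hcon, htT⟩
      obtain ⟨s, hs, hbs⟩ := this
      rcases hs.2.lt_or_eq with hlt | rfl
      · filter_upwards [lt_mem_nhds hlt] with x hx hx'
        exact absurd (hx'.1 s ⟨hs.1, hx.le⟩) (not_le.2 hbs)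
      · have := (hg s htT).eventually (lt_mem_nhds hbs)
        rw [eventually_nhdsWithin_iff] at this
        filter_upwards [this] with x hx hx'
        exact absurd (hx'.1 x ⟨hx'.2.1, le_rfl⟩) (not_le.2 (hx hx'.2))
    refine hcl.Icc_subset_of_forall_mem_nhdsWithin ?_ ?_
    · intro s hs
      rw [le_antisymm hs.2 hs.1]; exact h0
    · rintro t ⟨ht, ht'⟩
      have hta : g t < b := (h t ⟨ht'.1, ht'.2.le⟩ ht).trans_lt hab
      have := (hg t ⟨ht'.1, ht'.2.le⟩).eventually (gt_mem_nhds hta)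
      rw [eventually_nhdsWithin_iff, Metric.eventually_nhds_iff] at this
      obtain ⟨d, hd, hd'⟩ := this
      have : Set.Ioo t (min (t + d) T) ∈ 𝓝[>] t :=
        Ioo_mem_nhdsGT (lt_min (by linarith) ht'.2)
      filter_upwards [this] with x hx s hs
      by_cases hst : s ≤ t
      · exact ht s ⟨hs.1, hst⟩
      · push Not at hst
        have h1 := lt_min_iff.1 hx.2
        refine (hd' ?_ ⟨hs.1, hs.2.trans h1.2.le⟩).le
        rw [Real.dist_eq, abs_of_pos (by linarith)]
        linarith [hs.2]
  exact fun t ht => h t ht (key ht)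

section

variable {E : Type*} [NormedAddCommGroup E] [NormedSpace ℝ E]

/-- A bounded Lipschitz vector field on a Banach space has forward-complete solutions. -/
theorem exists_solution_of_lipschitz_of_bounded [CompleteSpace E] {F : E → E} {K L : NNReal}
    (hK : LipschitzWith K F) (hL : ∀ x, ‖F x‖ ≤ L) (x₀ : E) :
    ∃ x : ℝ → E, x 0 = x₀ ∧ ∀ t, 0 ≤ t → HasDerivWithinAt x (F (x t)) (Set.Ici 0) t := by
  have hloc : ∀ N : ℕ, ∃ x : ℝ → E, x 0 = x₀ ∧
      ∀ t ∈ Set.Icc (0 : ℝ) (N + 1), HasDerivWithinAt x (F (x t)) (Set.Icc 0 (N + 1)) t := by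
    intro N
    have h0 : (0 : ℝ) ∈ Set.Icc (0 : ℝ) (N + 1) := ⟨le_rfl, by positivity⟩
    -- In time `N + 1` a field bounded by `L` cannot leave the ball of radius `L * (N + 1)`, so no
    -- smallness of the interval is needed.
    have : IsPicardLindelof (fun _ => F) (⟨0, h0⟩ : Set.Icc (0 : ℝ) (N + 1)) x₀
        (L * (N + 1)) 0 L K :=
      { lipschitzOnWith := fun _ _ => hK.lipschitzOnWith
        continuousOn := fun _ _ => continuousOn_const
        norm_le := fun _ _ x _ => hL x
        mul_max_le := by
          have : (0 : ℝ) ≤ N + 1 := by positivity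
          simp [this] }
    exact this.exists_eq_forall_mem_Icc_hasDerivWithinAt₀
  choose α hα0 hα using hloc
  have hright : ∀ (N : ℕ) (T : ℝ), T ≤ N + 1 → ∀ t ∈ Set.Ico 0 T,
      HasDerivWithinAt (α N) (F (α N t)) (Set.Ici t) t := by
    intro N T hT t ht
    refine (hα N t ⟨ht.1, ht.2.le.trans hT⟩).mono_of_mem_nhdsWithin ?_
    exact mem_of_superset (Icc_mem_nhdsGE (ht.2.trans_le hT)) (Set.Icc_subset_Icc_left ht.1)
  have hcont : ∀ (N : ℕ) (T : ℝ), T ≤ N + 1 → ContinuousOn (α N) (Set.Icc 0 T) := by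
    intro N T hT t ht
    exact ((hα N t ⟨ht.1, ht.2.trans hT⟩).continuousWithinAt).mono (Set.Icc_subset_Icc_right hT)
  have hagree : ∀ (M N : ℕ) (t : ℝ), 0 ≤ t → t ≤ M + 1 → t ≤ N + 1 → α M t = α N t := by
    intro M N t ht hM hN
    exact ODE_solution_unique (v := fun _ => F) (fun _ => hK) (hcont M t hM) (hright M t hM)
      (hcont N t hN) (hright N t hN) ((hα0 M).trans (hα0 N).symm) ⟨ht, le_rfl⟩
  have hx : ∀ (N : ℕ) (s : ℝ), 0 ≤ s → s ≤ N + 1 → α ⌈s⌉₊ s = α N s := fun N s hs hN =>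
    hagree _ _ s hs ((Nat.le_ceil s).trans (by linarith)) hN
  -- The local solutions agree where both live. The extra unit in `N + 1` leaves a neighbourhood of
  -- `t` on which a single one of them represents the glued curve.
  refine ⟨fun s => α ⌈s⌉₊ s, by simp [hα0], fun t ht => ?_⟩
  set N := ⌈t⌉₊
  have htN : t < N + 1 := (Nat.le_ceil t).trans_lt (by simp [N])
  have h1 : HasDerivWithinAt (α N) (F (α N t)) (Set.Ici 0) t := by
    refine (hα N t ⟨ht, htN.le⟩).mono_of_mem_nhdsWithin ?_
    filter_upwards [mem_nhdsWithin_of_mem_nhds (gt_mem_nhds htN), self_mem_nhdsWithin] with s h1 h2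
    exact ⟨h2, h1.le⟩
  refine h1.congr_of_eventuallyEq ?_ rfl
  filter_upwards [mem_nhdsWithin_of_mem_nhds (gt_mem_nhds htN), self_mem_nhdsWithin] with s h1 h2
  exact hx N s h2 h1.le

/-- A continuously differentiable vector field whose solutions from `x₀` obey an a priori bound has
a solution from `x₀` for all forward times. -/
theorem exists_solution_of_apriori_bound [FiniteDimensional ℝ E] {F : E → E}
    (hF : ContDiff ℝ 1 F) (x₀ : E) (r : ℝ)
    (h : ∀ T, 0 ≤ T → ∀ x : ℝ → E, x 0 = x₀ →
      (∀ t ∈ Set.Icc 0 T, HasDerivWithinAt x (F (x t)) (Set.Icc 0 T) t) → ‖x T‖ ≤ r) :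
    ∃ x : ℝ → E, x 0 = x₀ ∧ ∀ t, 0 ≤ t → HasDerivWithinAt x (F (x t)) (Set.Ici 0) t := by
  have : CompleteSpace E := FiniteDimensional.complete ℝ E
  have hx₀ : ‖x₀‖ ≤ r := by
    refine h 0 le_rfl (fun _ => x₀) rfl fun t ht => ?_
    have ht0 : t = 0 := le_antisymm ht.2 ht.1
    subst ht0
    rw [Set.Icc_self]
    exact hasDerivWithinAt_iff_hasFDerivWithinAt.2 .singleton
  have hr : 0 ≤ r := (norm_nonneg _).trans hx₀
  -- The cutoff equals one up to radius `r + 1`, strictly beyond the a priori bound `r`. This is the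
  -- gap needed to show that the truncated solution never meets the cutoff.
  let χ : ContDiffBump (0 : E) := ⟨r + 1, r + 2, by linarith, by linarith⟩
  have hG : ContDiff ℝ 1 fun x => χ x • F x := (χ.contDiff).smul hF
  have hsupp : HasCompactSupport fun x => χ x • F x := χ.hasCompactSupport.smul_right
  obtain ⟨K, hK⟩ := hG.lipschitzWith_of_hasCompactSupport hsupp one_ne_zero
  obtain ⟨L, hL⟩ := hsupp.exists_bound_of_continuous hG.continuous
  have hL0 : 0 ≤ L := (norm_nonneg _).trans (hL 0)
  obtain ⟨x, hx0, hx⟩ := exists_solution_of_lipschitz_of_bounded (L := ⟨L, hL0⟩) hK hL x₀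
  have hbd : ∀ T, 0 ≤ T → ‖x T‖ ≤ r := by
    intro T hT
    refine le_of_bootstrap (g := fun t => ‖x t‖) (b := r + 1) (by linarith) (fun t ht => ?_)
      (by simp only [hx0]; linarith) (fun t ht hs => ?_) T ⟨hT, le_rfl⟩
    · exact (((hx t ht.1).continuousWithinAt).mono Set.Icc_subset_Ici_self).norm
    · refine h t ht.1 x hx0 fun s hs' => ?_
      have h1 := (hx s hs'.1).mono (fun y (hy : y ∈ Set.Icc 0 t) => hy.1)
      rwa [χ.one_of_mem_closedBall (by simpa [χ] using hs s hs'), one_smul] at h1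
  refine ⟨x, hx0, fun t ht => ?_⟩
  have h1 := hx t ht
  rwa [χ.one_of_mem_closedBall (by simpa [χ] using (hbd t ht).trans (by linarith)), one_smul] at h1

end

/-- The differential inequality `f' ≤ -γ f` on `[0, T]` gives exponential decay. -/
theorem le_exp_mul_of_deriv_le {f f' : ℝ → ℝ} {γ T : ℝ}
    (hf : ∀ t ∈ Set.Icc 0 T, HasDerivWithinAt f (f' t) (Set.Icc 0 T) t)
    (hle : ∀ t ∈ Set.Icc 0 T, f' t ≤ -γ * f t) :
    ∀ t ∈ Set.Icc 0 T, f t ≤ Real.exp (-γ * t) * f 0 := by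
  have hd : ∀ t ∈ Set.Icc 0 T, HasDerivWithinAt (fun s => Real.exp (γ * s) * f s)
      (Real.exp (γ * t) * γ * f t + Real.exp (γ * t) * f' t) (Set.Icc 0 T) t := by
    intro t ht
    have h1 : HasDerivAt (fun s => Real.exp (γ * s)) (Real.exp (γ * t) * γ) t := by
      simpa using ((hasDerivAt_id t).const_mul γ).exp
    exact h1.hasDerivWithinAt.mul (hf t ht)
  have hanti : AntitoneOn (fun s => Real.exp (γ * s) * f s) (Set.Icc 0 T) := by
    refine antitoneOn_of_hasDerivWithinAt_nonpos (convex_Icc 0 T)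
      (fun t ht => (hd t ht).continuousWithinAt)
      (fun t ht => (hd t (interior_subset ht)).mono interior_subset) fun t ht => ?_
    have h1 := hle t (interior_subset ht)
    have h2 := Real.exp_pos (γ * t)
    nlinarith
  intro t ht
  have h := hanti ⟨le_rfl, ht.1.trans ht.2⟩ ht ht.1
  simp only [mul_zero, Real.exp_zero, one_mul] at h
  calc f t = Real.exp (-γ * t) * (Real.exp (γ * t) * f t) := by
        rw [← mul_assoc, ← Real.exp_add]; simp
    _ ≤ _ := mul_le_mul_of_nonneg_left h (Real.exp_pos _).le

/-! ### Lyapunov function and dissipation -/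

/-- Quadratic estimate behind the dissipation inequality. -/
theorem dissipation_real {M lam ν E W F Q R B G : ℝ} (hM : 1 ≤ M) (hlam : 0 < lam) (hlam1 : lam ≤ 1)
    (hν : 0 ≤ ν) (hν' : M ^ 2 * ν ≤ 1 / (16 * M ^ 2) * lam / 16)
    (hE : 0 ≤ E) (hW : 0 ≤ W) (hEM : E ≤ M) (hF0 : 0 ≤ F) (hF : F ≤ M * ν * E)
    (hQ0 : 0 ≤ Q) (hQ : Q ≤ M * ν * W) (hR0 : 0 ≤ R) (hR : R ≤ M * W) (hB : B ≤ M * (W + ν) * W)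
    (hG : G ≤ M * E) (hG' : lam * E ^ 2 ≤ G ^ 2) :
    (1 / (16 * M ^ 2) + 1) * (E * F) - W ^ 2 + W * Q
      + 1 / (16 * M ^ 2) * (2 * R ^ 2 + 2 * (F * R) + E * B - G ^ 2 + G * Q)
      ≤ -(1 / (16 * M ^ 2) * lam / 2) * E ^ 2 - 1 / 2 * W ^ 2 := by
  set ε := 1 / (16 * M ^ 2) with hε
  have hM2 : 1 ≤ M ^ 2 := by nlinarith
  -- This choice of ε turns the cross-term contribution of order M² W² into 3/16 W², which -W²
  -- absorbs. Terms carrying ν are absorbed by the smallness `hν'`.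
  have hεM : ε * M ^ 2 = 1 / 16 := by rw [hε]; field_simp
  have hε0 : 0 < ε := by positivity
  have hε1 : ε ≤ 1 / 16 := by
    rw [← hεM]; exact le_mul_of_one_le_right hε0.le hM2
  clear_value ε
  have hMM : M * ν ≤ M ^ 2 * ν := by nlinarith [mul_nonneg (by linarith : 0 ≤ M) hν]
  have hEW : 2 * (E * W) ≤ E ^ 2 + W ^ 2 := by nlinarith [sq_nonneg (E - W)]
  have hMν : 0 ≤ M ^ 2 * ν := by positivity
  have hEW0 : 0 ≤ E * W := by positivity
  have h1 : E * F ≤ M ^ 2 * ν * E ^ 2 := by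
    calc E * F ≤ E * (M * ν * E) := by gcongr
      _ = M * ν * E ^ 2 := by ring
      _ ≤ _ := by gcongr
  have h2 : W * Q ≤ M ^ 2 * ν * W ^ 2 := by
    calc W * Q ≤ W * (M * ν * W) := by gcongr
      _ = M * ν * W ^ 2 := by ring
      _ ≤ _ := by gcongr
  have h3 : R ^ 2 ≤ M ^ 2 * W ^ 2 := by rw [← mul_pow]; gcongr
  have h4 : F * R ≤ M ^ 2 * ν * (E * W) := by
    calc F * R ≤ (M * ν * E) * (M * W) := by gcongr
      _ = _ := by ring
  have h5 : E * B ≤ M ^ 2 * W ^ 2 + M ^ 2 * ν * (E * W) := by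
    calc E * B ≤ E * (M * (W + ν) * W) := by gcongr
      _ = E * (M * W ^ 2) + M * ν * (E * W) := by ring
      _ ≤ M * (M * W ^ 2) + M ^ 2 * ν * (E * W) := by gcongr
      _ = _ := by ring
  have h6 : G * Q ≤ M ^ 2 * ν * (E * W) := by
    calc G * Q ≤ (M * E) * (M * ν * W) := by gcongr
      _ = _ := by ring
  have h7 : M ^ 2 * ν * (E * W) ≤ M ^ 2 * ν * ((E ^ 2 + W ^ 2) / 2) := by
    gcongr; linarith
  have hb : 2 * R ^ 2 + 2 * (F * R) + E * B - G ^ 2 + G * Q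
      ≤ 3 * (M ^ 2 * W ^ 2) + 2 * (M ^ 2 * ν * (E ^ 2 + W ^ 2)) - lam * E ^ 2 := by
    linarith
  have hb' := mul_le_mul_of_nonneg_left hb hε0.le
  have hc : ε * (3 * (M ^ 2 * W ^ 2)) = 3 / 16 * W ^ 2 := by
    rw [show ε * (3 * (M ^ 2 * W ^ 2)) = 3 * (ε * M ^ 2) * W ^ 2 by ring, hεM]; ring
  have hd : ε * (2 * (M ^ 2 * ν * (E ^ 2 + W ^ 2))) ≤ 1 / 8 * (M ^ 2 * ν * (E ^ 2 + W ^ 2)) := by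
    have : 0 ≤ M ^ 2 * ν * (E ^ 2 + W ^ 2) := by positivity
    have := mul_le_mul_of_nonneg_right hε1 this
    linarith
  have he : (ε + 1) * (E * F) ≤ 2 * (M ^ 2 * ν * E ^ 2) := by
    have : 0 ≤ E * F := by positivity
    have := mul_le_mul_of_nonneg_right hε1 this
    linarith
  have hE2 : M ^ 2 * ν * E ^ 2 ≤ ε * lam / 16 * E ^ 2 := by gcongr
  have hW2 : M ^ 2 * ν * W ^ 2 ≤ 1 / 256 * W ^ 2 := by
    have h8 : ε * lam ≤ 1 / 16 * 1 := mul_le_mul hε1 hlam1 hlam.le (by norm_num)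
    exact mul_le_mul_of_nonneg_right (by linarith) (sq_nonneg W)
  have hlE : 0 ≤ ε * lam * E ^ 2 := by positivity
  have hW0 : 0 ≤ W ^ 2 := by positivity
  linarith

section

set_option linter.unusedSectionVars false

open ContinuousLinearMap

variable {H₁ H₂ H₃ : Type*} [NormedAddCommGroup H₁] [InnerProductSpace ℝ H₁] [CompleteSpace H₁]
  [NormedAddCommGroup H₂] [InnerProductSpace ℝ H₂] [CompleteSpace H₂]
  [NormedAddCommGroup H₃] [InnerProductSpace ℝ H₃] [CompleteSpace H₃]
  (P : H₁ →L[ℝ] H₂) (β : H₂ →L[ℝ] H₂ →L[ℝ] H₃) (e₀ : H₃) (N : H₂ →L[ℝ] H₁)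

/-- The quadratic error map `z ↦ β(z, z) - e₀`. -/
noncomputable def quadError (z : H₂) : H₃ := β z z - e₀

/-- Closed-loop acceleration with unit gains, written with the relative position map `P`, the
bilinear form `β` of the squared lengths, and the velocity map `N`. -/
noncomputable def accel (p v : H₁) : H₁ :=
  -v - adjoint ((β (P p)).comp P) (quadError β e₀ (P p)) + N (P p) + N (P (N (P p)))

/-- Solutions on a time set of the closed loop with unit gains. -/
def IsSol (S : Set ℝ) (p v : ℝ → H₁) : Prop :=
  ∀ t ∈ S, HasDerivWithinAt p (v t) S t ∧ HasDerivWithinAt v (accel P β e₀ N (p t) (v t)) S t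

/-- The velocity error. -/
def velErr (p v : H₁) : H₁ := v - N (P p)

/-- The Lyapunov function, with cross term. -/
noncomputable def lyap (ε : ℝ) (p v : H₁) : ℝ :=
  (ε + 1) / 4 * ‖quadError β e₀ (P p)‖ ^ 2 + 1 / 2 * ‖velErr P N p v‖ ^ 2
    + ε * inner ℝ (quadError β e₀ (P p)) (β (P p) (P (velErr P N p v)))

/-- The derivative of the Lyapunov function along solutions. -/
noncomputable def lyapDeriv (ε : ℝ) (p v : H₁) : ℝ :=
  let e := quadError β e₀ (P p)
  let w := velErr P N p v
  let g := adjoint ((β (P p)).comp P) e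
  let f := β (P p) (P (N (P p)))
  let r := β (P p) (P w)
  (ε + 1) * inner ℝ e f - ‖w‖ ^ 2 - inner ℝ w (N (P w))
    + ε * (2 * ‖r‖ ^ 2 + 2 * inner ℝ f r + inner ℝ e (β (P w + P (N (P p))) (P w)) - ‖g‖ ^ 2
      - inner ℝ g (N (P w)))

variable {P β e₀ N}

theorem hasDerivWithinAt_velErr {S : Set ℝ} {p v : ℝ → H₁} (h : IsSol P β e₀ N S p v) {t : ℝ}
    (ht : t ∈ S) :
    HasDerivWithinAt (fun t => velErr P N (p t) (v t))
      (-(velErr P N (p t) (v t)) - adjoint ((β (P (p t))).comp P) (quadError β e₀ (P (p t)))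
        - N (P (velErr P N (p t) (v t)))) S t := by
  obtain ⟨hp, hv⟩ := h t ht
  have := hv.sub ((N.comp P).hasFDerivAt.comp_hasDerivWithinAt t hp)
  refine this.congr_deriv ?_
  simp only [accel, velErr, ContinuousLinearMap.comp_apply, map_sub]
  abel

theorem hasDerivWithinAt_rel {S : Set ℝ} {p v : ℝ → H₁} (h : IsSol P β e₀ N S p v) {t : ℝ}
    (ht : t ∈ S) :
    HasDerivWithinAt (fun t => P (p t)) (P (velErr P N (p t) (v t)) + P (N (P (p t)))) S t := by
  refine (P.hasFDerivAt.comp_hasDerivWithinAt t (h t ht).1).congr_deriv ?_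
  rw [← map_add]; simp [velErr]

theorem hasDerivWithinAt_quadError (hβ : ∀ x y, β x y = β y x) {S : Set ℝ} {z : ℝ → H₂} {z' : H₂}
    {t : ℝ} (h : HasDerivWithinAt z z' S t) :
    HasDerivWithinAt (fun t => quadError β e₀ (z t)) ((2 : ℝ) • β (z t) z') S t := by
  have := (β.isBoundedBilinearMap.hasFDerivAt (z t, z t)).comp_hasDerivWithinAt t (h.prodMk h)
  refine (this.sub_const e₀).congr_deriv ?_
  simp [IsBoundedBilinearMap.deriv, hβ z' (z t), two_smul]

/-- The weight (ε + 1)/4 is what cancels the indefinite term ⟨e, r⟩: the first square contributes ε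
+ 1 of it, the velocity square -1, and the damping inside the cross term -ε. -/
theorem hasDerivWithinAt_lyap (hβ : ∀ x y, β x y = β y x) (ε : ℝ) {S : Set ℝ} {p v : ℝ → H₁}
    (h : IsSol P β e₀ N S p v) {t : ℝ} (ht : t ∈ S) :
    HasDerivWithinAt (fun t => lyap P β e₀ N ε (p t) (v t)) (lyapDeriv P β e₀ N ε (p t) (v t)) S
      t := by
  have hz := hasDerivWithinAt_rel h ht
  have hw := hasDerivWithinAt_velErr h ht
  have he := hasDerivWithinAt_quadError (e₀ := e₀) hβ hz
  have hr := (β.isBoundedBilinearMap.hasFDerivAt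
    (P (p t), P (velErr P N (p t) (v t)))).comp_hasDerivWithinAt t
      (hz.prodMk (P.hasFDerivAt.comp_hasDerivWithinAt t hw))
  have := ((he.norm_sq.const_mul ((ε + 1) / 4)).add (hw.norm_sq.const_mul (1 / 2))).add
    ((he.inner ℝ hr).const_mul ε)
  refine this.congr_deriv ?_
  have hg : ∀ x, inner ℝ (quadError β e₀ (P (p t))) (β (P (p t)) (P x)) =
      inner ℝ (adjoint ((β (P (p t))).comp P) (quadError β e₀ (P (p t)))) x := fun x => by
    rw [adjoint_inner_left]; rfl
  simp only [lyapDeriv, Function.comp_apply]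
  set w := velErr P N (p t) (v t)
  set g := adjoint ((β (P (p t))).comp P) (quadError β e₀ (P (p t)))
  set e := quadError β e₀ (P (p t))
  set z := P (p t)
  have hd : (β.isBoundedBilinearMap.deriv (z, P w)) (P w + P (N z), P (-w - g - N (P w))) =
      β z (P (-w - g - N (P w))) + β (P w + P (N z)) (P w) := by
    simp [IsBoundedBilinearMap.deriv]
  rw [hd, inner_add_right, hg, inner_smul_left, inner_smul_right, map_add (β z) (P w) (P (N z)),
    inner_add_right, inner_add_left, hg w]
  simp only [inner_sub_right, inner_neg_right, real_inner_self_eq_norm_sq, real_inner_comm g w,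
    conj_trivial]
  ring

end

section

set_option linter.unusedSectionVars false

open ContinuousLinearMap

variable {H₁ H₂ H₃ : Type*} [NormedAddCommGroup H₁] [InnerProductSpace ℝ H₁] [CompleteSpace H₁]
  [NormedAddCommGroup H₂] [InnerProductSpace ℝ H₂] [CompleteSpace H₂]
  [NormedAddCommGroup H₃] [InnerProductSpace ℝ H₃] [CompleteSpace H₃]
  {P : H₁ →L[ℝ] H₂} {β : H₂ →L[ℝ] H₂ →L[ℝ] H₃} {e₀ : H₃} {N : H₂ →L[ℝ] H₁}

theorem lyapDeriv_le {M lam : ℝ} (hM : 1 ≤ M) (hlam : 0 < lam) (hlam1 : lam ≤ 1)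
    (hν : M ^ 2 * ‖N‖ ≤ 1 / (16 * M ^ 2) * lam / 16) {p v : H₁}
    (he : ‖quadError β e₀ (P p)‖ ≤ M)
    (hf : ‖β (P p) (P (N (P p)))‖ ≤ M * ‖N‖ * ‖quadError β e₀ (P p)‖)
    (hq : ‖N (P (velErr P N p v))‖ ≤ M * ‖N‖ * ‖velErr P N p v‖)
    (hr : ‖β (P p) (P (velErr P N p v))‖ ≤ M * ‖velErr P N p v‖)
    (hb : ‖β (P (velErr P N p v) + P (N (P p))) (P (velErr P N p v))‖
      ≤ M * (‖velErr P N p v‖ + ‖N‖) * ‖velErr P N p v‖)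
    (hg : ‖adjoint ((β (P p)).comp P) (quadError β e₀ (P p))‖ ≤ M * ‖quadError β e₀ (P p)‖)
    (hg' : lam * ‖quadError β e₀ (P p)‖ ^ 2
      ≤ ‖adjoint ((β (P p)).comp P) (quadError β e₀ (P p))‖ ^ 2) :
    lyapDeriv P β e₀ N (1 / (16 * M ^ 2)) p v ≤
      -(1 / (16 * M ^ 2) * lam / 2) * ‖quadError β e₀ (P p)‖ ^ 2
        - 1 / 2 * ‖velErr P N p v‖ ^ 2 := by
  refine le_trans ?_ (dissipation_real hM hlam hlam1 (norm_nonneg N) hν (norm_nonneg _)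
    (norm_nonneg _) he (norm_nonneg _) hf (norm_nonneg _) hq (norm_nonneg _) hr hb hg hg')
  simp only [lyapDeriv]
  have hε : 0 ≤ 1 / (16 * M ^ 2) := by positivity
  set w := velErr P N p v
  set e := quadError β e₀ (P p)
  set g := adjoint ((β (P p)).comp P) e
  set f := β (P p) (P (N (P p)))
  set r := β (P p) (P w)
  have h1 := real_inner_le_norm e f
  have h2 := neg_le_of_abs_le (abs_real_inner_le_norm w (N (P w)))
  have h3 := real_inner_le_norm f r
  have h4 := real_inner_le_norm e (β (P w + P (N (P p))) (P w))
  have h5 := neg_le_of_abs_le (abs_real_inner_le_norm g (N (P w)))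
  have h6 := mul_le_mul_of_nonneg_left h1 (by linarith : 0 ≤ 1 / (16 * M ^ 2) + 1)
  have h7 : 2 * ‖r‖ ^ 2 + 2 * inner ℝ f r + inner ℝ e (β (P w + P (N (P p))) (P w)) - ‖g‖ ^ 2
      - inner ℝ g (N (P w)) ≤ 2 * ‖r‖ ^ 2 + 2 * (‖f‖ * ‖r‖)
      + ‖e‖ * ‖β (P w + P (N (P p))) (P w)‖ - ‖g‖ ^ 2 + ‖g‖ * ‖N (P w)‖ := by linarith
  have h8 := mul_le_mul_of_nonneg_left h7 hε
  linarith

theorem norm_adjoint_comp_le (z : H₂) (y : H₃) :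
    ‖adjoint ((β z).comp P) y‖ ≤ ‖β‖ * ‖z‖ * ‖P‖ * ‖y‖ := by
  refine (le_opNorm _ _).trans ?_
  rw [LinearIsometryEquiv.norm_map]
  gcongr
  exact (opNorm_comp_le _ _).trans (by gcongr; exact le_opNorm _ _)

/-- The adjoint depends linearly on the base point, so a lower bound on the shape set survives
nearby with a loss proportional to the distance. -/
theorem le_norm_adjoint_of_close {c d : ℝ} {z z' : H₂} {y : H₃}
    (hc : c * ‖y‖ ≤ ‖adjoint ((β z').comp P) y‖) (hd : ‖β‖ * ‖z - z'‖ * ‖P‖ ≤ d) :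
    (c - d) * ‖y‖ ≤ ‖adjoint ((β z).comp P) y‖ := by
  have h1 : adjoint ((β z).comp P) y = adjoint ((β z').comp P) y
      + adjoint ((β (z - z')).comp P) y := by
    rw [← _root_.add_apply, ← map_add, ← add_comp, ← map_add, add_sub_cancel]
  have h2 := norm_adjoint_comp_le (P := P) (β := β) (z - z') y
  have h3 := norm_sub_le_norm_add (adjoint ((β z').comp P) y) (adjoint ((β (z - z')).comp P) y)
  rw [← h1] at h3
  have h4 := mul_le_mul_of_nonneg_right hd (norm_nonneg y)
  linarith

/-- Near the shape set the Lyapunov derivative is negative definite, uniformly in all small velocity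
maps which move the shape set by rigid motions. -/
theorem exists_lyapDeriv_bound {Z : Set H₂} {δ C c Y : ℝ} (hδ : 0 < δ) (hC : 0 ≤ C)
    (hc : 0 < c)
    (hnear : ∀ p, Metric.infDist (P p) Z ≤ δ → ∃ z ∈ Z, ‖P p - z‖ ≤ C * ‖quadError β e₀ (P p)‖)
    (hcoer : ∀ z ∈ Z, ∀ y, c * ‖y‖ ≤ ‖adjoint ((β z).comp P) y‖) (hY : ∀ z ∈ Z, ‖z‖ ≤ Y)
    (hY0 : 0 ≤ Y) :
    ∃ M ≥ (1 : ℝ), ∃ lam > (0 : ℝ), lam ≤ 1 ∧ ∃ η > (0 : ℝ), C * η ≤ δ / 2 ∧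
      (∀ N : H₂ →L[ℝ] H₁, M ^ 2 * ‖N‖ ≤ 1 / (16 * M ^ 2) * lam / 16 →
        (∀ z ∈ Z, β z (P (N z)) = 0) → ∀ p v, Metric.infDist (P p) Z ≤ δ →
        ‖quadError β e₀ (P p)‖ ≤ η →
        ‖β (P p) (P (velErr P N p v))‖ ≤ M * ‖velErr P N p v‖ ∧
        lyapDeriv P β e₀ N (1 / (16 * M ^ 2)) p v ≤
          -(1 / (16 * M ^ 2) * lam / 2) * ‖quadError β e₀ (P p)‖ ^ 2
            - 1 / 2 * ‖velErr P N p v‖ ^ 2) := by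
  set b := ‖β‖
  set a := ‖P‖
  have hb0 : 0 ≤ b := norm_nonneg β
  have ha0 : 0 ≤ a := norm_nonneg P
  set X := Y + C
  have hX : 0 ≤ X := by positivity
  set M := 1 + b * X * a + 2 * b * a * X * C + a + b * a ^ 2 + b * a ^ 2 * X with hMdef
  have t1 : 0 ≤ b * X * a := by positivity
  have t2 : 0 ≤ 2 * b * a * X * C := by positivity
  have t3 : 0 ≤ b * a ^ 2 := by positivity
  have t4 : 0 ≤ b * a ^ 2 * X := by positivity
  have hM : 1 ≤ M := by linarith
  -- The three conditions on η keep z bounded, make the distance to the shape set at most δ/2, and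
  -- lose at most half of the coercivity constant `c`.
  obtain ⟨η, hη, hη1, hη2, hη3⟩ : ∃ η > (0 : ℝ), η ≤ 1 ∧ C * η ≤ δ / 2 ∧ b * (C * η) * a ≤ c / 2 := by
    refine ⟨min 1 (min (δ / (2 * (C + 1))) (c / (2 * (b * C * a + 1)))), by positivity,
      min_le_left _ _, ?_, ?_⟩
    · calc C * min 1 (min (δ / (2 * (C + 1))) (c / (2 * (b * C * a + 1))))
          ≤ (C + 1) * (δ / (2 * (C + 1))) := by
            gcongr
            · linarith
            · exact (min_le_right _ _).trans (min_le_left _ _)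
        _ = δ / 2 := by field_simp
    · have : 0 ≤ b * C * a := by positivity
      calc b * (C * min 1 (min (δ / (2 * (C + 1))) (c / (2 * (b * C * a + 1))))) * a
          = b * C * a * min 1 (min (δ / (2 * (C + 1))) (c / (2 * (b * C * a + 1)))) := by ring
        _ ≤ (b * C * a + 1) * (c / (2 * (b * C * a + 1))) := by
            gcongr
            · linarith
            · exact (min_le_right _ _).trans (min_le_right _ _)
        _ = c / 2 := by field_simp
  refine ⟨M, hM, min 1 (c ^ 2 / 4), by positivity, min_le_left _ _, η, hη, hη2, ?_⟩
  intro N hN htan p v hp he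
  obtain ⟨z', hz', hzz'⟩ := hnear p hp
  set e := quadError β e₀ (P p) with he_def
  set w := velErr P N p v
  set z := P p
  have he0 := norm_nonneg e
  have hw0 := norm_nonneg w
  have hN0 := norm_nonneg N
  have hz'X : ‖z'‖ ≤ X := (hY z' hz').trans (by linarith)
  have hzX : ‖z‖ ≤ X := by
    have : ‖z‖ ≤ ‖z'‖ + ‖z - z'‖ := norm_le_norm_add_norm_sub' z z'
    have h2 : C * ‖e‖ ≤ C := mul_le_of_le_one_right hC (he.trans hη1)
    linarith [hY z' hz']
  have hPw : ‖P w‖ ≤ a * ‖w‖ := P.le_opNorm w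
  have hPN : ∀ x, ‖P (N x)‖ ≤ a * (‖N‖ * ‖x‖) := fun x =>
    (P.le_opNorm _).trans (by gcongr; exact N.le_opNorm x)
  have hbil : ∀ x y, ‖β x y‖ ≤ b * ‖x‖ * ‖y‖ := β.le_opNorm₂
  have hr : ‖β z (P w)‖ ≤ M * ‖w‖ := by
    calc ‖β z (P w)‖ ≤ b * ‖z‖ * ‖P w‖ := hbil _ _
      _ ≤ b * X * (a * ‖w‖) := by gcongr
      _ = (b * X * a) * ‖w‖ := by ring
      _ ≤ M * ‖w‖ := by gcongr; linarith
  refine ⟨hr, lyapDeriv_le hM (by positivity) (min_le_left _ _) hN (by linarith) ?_ ?_ hr ?_ ?_ ?_⟩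
  · have hsplit : β z (P (N z)) = β (z - z') (P (N z)) + β z' (P (N (z - z'))) := by
      simp [htan z' hz']
    rw [hsplit]
    calc ‖β (z - z') (P (N z)) + β z' (P (N (z - z')))‖
        ≤ b * ‖z - z'‖ * ‖P (N z)‖ + b * ‖z'‖ * ‖P (N (z - z'))‖ :=
          (norm_add_le _ _).trans (add_le_add (hbil _ _) (hbil _ _))
      _ ≤ b * ‖z - z'‖ * (a * (‖N‖ * X)) + b * X * (a * (‖N‖ * ‖z - z'‖)) := by
          gcongr
          · exact (hPN z).trans (by gcongr)
          · exact hPN _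
      _ = 2 * b * a * X * ‖N‖ * ‖z - z'‖ := by ring
      _ ≤ 2 * b * a * X * ‖N‖ * (C * ‖e‖) := by gcongr
      _ = (2 * b * a * X * C) * ‖N‖ * ‖e‖ := by ring
      _ ≤ M * ‖N‖ * ‖e‖ := by gcongr; linarith
  · calc ‖N (P w)‖ ≤ ‖N‖ * ‖P w‖ := N.le_opNorm _
      _ ≤ ‖N‖ * (a * ‖w‖) := by gcongr
      _ = a * ‖N‖ * ‖w‖ := by ring
      _ ≤ M * ‖N‖ * ‖w‖ := by gcongr; linarith
  · calc ‖β (P w + P (N z)) (P w)‖ ≤ b * ‖P w + P (N z)‖ * ‖P w‖ := hbil _ _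
      _ ≤ b * (a * ‖w‖ + a * (‖N‖ * X)) * (a * ‖w‖) := by
          gcongr
          exact (norm_add_le _ _).trans (add_le_add hPw ((hPN z).trans (by gcongr)))
      _ = (b * a ^ 2 * ‖w‖ + (b * a ^ 2 * X) * ‖N‖) * ‖w‖ := by ring
      _ ≤ (M * ‖w‖ + M * ‖N‖) * ‖w‖ := by gcongr <;> linarith
      _ = M * (‖w‖ + ‖N‖) * ‖w‖ := by ring
  · refine (norm_adjoint_comp_le z e).trans ?_
    calc b * ‖z‖ * a * ‖e‖ ≤ b * X * a * ‖e‖ := by gcongr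
      _ ≤ M * ‖e‖ := by gcongr; linarith
  · have h1 := le_norm_adjoint_of_close (z := z) (d := c / 2) (hcoer z' hz' e) (by
      calc b * ‖z - z'‖ * a ≤ b * (C * η) * a := by
            gcongr; exact hzz'.trans (by gcongr)
        _ ≤ c / 2 := hη3)
    calc min 1 (c ^ 2 / 4) * ‖e‖ ^ 2 ≤ c ^ 2 / 4 * ‖e‖ ^ 2 := by gcongr; exact min_le_right _ _
      _ = ((c - c / 2) * ‖e‖) ^ 2 := by ring
      _ ≤ _ := by
        have : 0 ≤ (c - c / 2) * ‖e‖ := mul_nonneg (by linarith) he0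
        gcongr

theorem IsSol.mono {S S' : Set ℝ} {p v : ℝ → H₁} (h : IsSol P β e₀ N S p v) (hS : S' ⊆ S) :
    IsSol P β e₀ N S' p v := fun t ht => ⟨(h t (hS ht)).1.mono hS, (h t (hS ht)).2.mono hS⟩

theorem abs_lyap_sub_le {ε M : ℝ} (hε : 0 ≤ ε) (hεM : ε * M ≤ 1 / 16) {p v : H₁}
    (hr : ‖β (P p) (P (velErr P N p v))‖ ≤ M * ‖velErr P N p v‖) :
    |lyap P β e₀ N ε p v
        - ((ε + 1) / 4 * ‖quadError β e₀ (P p)‖ ^ 2 + 1 / 2 * ‖velErr P N p v‖ ^ 2)|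
      ≤ 1 / 16 * (‖quadError β e₀ (P p)‖ ^ 2 + ‖velErr P N p v‖ ^ 2) := by
  simp only [lyap, add_sub_cancel_left]
  set e := quadError β e₀ (P p)
  set w := velErr P N p v
  rw [abs_mul, abs_of_nonneg hε]
  calc ε * |inner ℝ e (β (P p) (P w))| ≤ ε * (‖e‖ * (M * ‖w‖)) := by
        gcongr
        exact (abs_real_inner_le_norm _ _).trans (by gcongr)
    _ = ε * M * (‖e‖ * ‖w‖) := by ring
    _ ≤ 1 / 16 * (‖e‖ * ‖w‖) := by gcongr
    _ ≤ 1 / 16 * (‖e‖ ^ 2 + ‖w‖ ^ 2) := by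
        nlinarith [sq_nonneg (‖e‖ - ‖w‖), sq_nonneg (‖e‖), sq_nonneg (‖w‖)]

/-- The cross term is at most 1/16 of ‖e‖² + ‖w‖², so the Lyapunov function is comparable with its
quadratic part on both sides. The assumed dissipation then makes its derivative at most -κ times
itself. -/
theorem norm_sq_le_exp_of_lyapDeriv_le (hβ : ∀ x y, β x y = β y x) {ε M κ T : ℝ} (hε : 0 ≤ ε)
    (hε1 : ε ≤ 1 / 16) (hεM : ε * M ≤ 1 / 16) (hκ : 0 ≤ κ) (hκ1 : κ ≤ 1 / 2) (hT : 0 ≤ T)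
    {p v : ℝ → H₁} (hsol : IsSol P β e₀ N (Set.Icc 0 T) p v)
    (hr : ∀ t ∈ Set.Icc 0 T, ‖β (P (p t)) (P (velErr P N (p t) (v t)))‖
      ≤ M * ‖velErr P N (p t) (v t)‖)
    (hd : ∀ t ∈ Set.Icc 0 T, lyapDeriv P β e₀ N ε (p t) (v t)
      ≤ -κ * ‖quadError β e₀ (P (p t))‖ ^ 2 - 1 / 2 * ‖velErr P N (p t) (v t)‖ ^ 2) :
    1 / 4 * ‖quadError β e₀ (P (p T))‖ ^ 2 + 1 / 4 * ‖velErr P N (p T) (v T)‖ ^ 2 ≤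
      3 * Real.exp (-κ * T) * ((ε + 1) / 4 * ‖quadError β e₀ (P (p 0))‖ ^ 2
        + 1 / 2 * ‖velErr P N (p 0) (v 0)‖ ^ 2) := by
  have hsq : ∀ x : ℝ, 1 / 4 * x ^ 2 ≤ (ε + 1) / 4 * x ^ 2 ∧ (ε + 1) / 4 * x ^ 2 ≤ 1 / 2 * x ^ 2 :=
    fun x => ⟨mul_le_mul_of_nonneg_right (by linarith) (sq_nonneg _),
      mul_le_mul_of_nonneg_right (by linarith) (sq_nonneg _)⟩
  have hequiv := fun t ht => abs_le.1 (abs_lyap_sub_le (e₀ := e₀) hε hεM (hr t ht))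
  have hexp := le_exp_mul_of_deriv_le (γ := κ) (fun s hs => hasDerivWithinAt_lyap hβ ε hsol hs)
    (fun s hs => by
      have h1 := (hequiv s hs).2
      have h2 := hd s hs
      set E := ‖quadError β e₀ (P (p s))‖
      set W := ‖velErr P N (p s) (v s)‖
      have h3 := (hsq E).2
      have hE := sq_nonneg E
      have hW := sq_nonneg W
      have h4 : lyap P β e₀ N ε (p s) (v s) ≤ E ^ 2 + W ^ 2 := by linarith
      have h5 := mul_le_mul_of_nonneg_left h4 hκ
      have h6 : κ * W ^ 2 ≤ 1 / 2 * W ^ 2 := mul_le_mul_of_nonneg_right hκ1 hW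
      linarith) T ⟨hT, le_rfl⟩
  have h1 := (hequiv T ⟨hT, le_rfl⟩).1
  have h2 := (hequiv 0 ⟨le_rfl, hT⟩).2
  set E := ‖quadError β e₀ (P (p T))‖
  set W := ‖velErr P N (p T) (v T)‖
  set E₀ := ‖quadError β e₀ (P (p 0))‖
  set W₀ := ‖velErr P N (p 0) (v 0)‖
  have h3 := (hsq E).1
  have h4 := (hsq E₀).1
  have hW := sq_nonneg W
  have hE := sq_nonneg E
  have hW₀ := sq_nonneg W₀
  have hE₀ := sq_nonneg E₀
  have h5 : lyap P β e₀ N ε (p 0) (v 0) ≤ 3 / 2 * ((ε + 1) / 4 * E₀ ^ 2 + 1 / 2 * W₀ ^ 2) := by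
    linarith
  have h6 := mul_le_mul_of_nonneg_left h5 (Real.exp_pos (-κ * T)).le
  linarith

/-- Uniform exponential decay of the errors, as long as the solution exists, from initial states
near the shape set. -/
theorem exists_uniform_decay (hβ : ∀ x y, β x y = β y x) {Z : Set H₂} {δ C c Y : ℝ} (hδ : 0 < δ)
    (hC : 0 ≤ C) (hc : 0 < c)
    (hnear : ∀ p, Metric.infDist (P p) Z ≤ δ → ∃ z ∈ Z, ‖P p - z‖ ≤ C * ‖quadError β e₀ (P p)‖)
    (hcoer : ∀ z ∈ Z, ∀ y, c * ‖y‖ ≤ ‖adjoint ((β z).comp P) y‖) (hY : ∀ z ∈ Z, ‖z‖ ≤ Y)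
    (hY0 : 0 ≤ Y) :
    ∃ ρ > (0 : ℝ), ∃ ν > (0 : ℝ), ∃ ε > (0 : ℝ), ∃ γ > (0 : ℝ), ‖P‖ * ν ≤ γ / 4 ∧
      (∀ p, Metric.infDist (P p) Z ≤ δ → (ε + 1) / 4 * ‖quadError β e₀ (P p)‖ ^ 2 ≤ ρ →
        Metric.infDist (P p) Z ≤ δ / 2) ∧
      ∀ N : H₂ →L[ℝ] H₁, ‖N‖ ≤ ν → (∀ z ∈ Z, β z (P (N z)) = 0) → ∀ T, ∀ p v : ℝ → H₁,
        IsSol P β e₀ N (Set.Icc 0 T) p v → Metric.infDist (P (p 0)) Z ≤ δ →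
        (ε + 1) / 4 * ‖quadError β e₀ (P (p 0))‖ ^ 2 + 1 / 2 * ‖velErr P N (p 0) (v 0)‖ ^ 2 ≤ ρ →
        ∀ t ∈ Set.Icc 0 T, Metric.infDist (P (p t)) Z ≤ δ ∧
          ‖quadError β e₀ (P (p t))‖ + ‖velErr P N (p t) (v t)‖ ≤
            5 * Real.exp (-γ * t) * (‖quadError β e₀ (P (p 0))‖ + ‖velErr P N (p 0) (v 0)‖) := by
  obtain ⟨M, hM, lam, hlam, hlam1, η, hη, hCη, hbound⟩ :=
    exists_lyapDeriv_bound hδ hC hc hnear hcoer hY hY0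
  set ε := 1 / (16 * M ^ 2) with hε_def
  have hM2 : 1 ≤ M ^ 2 := by nlinarith
  have hε : 0 < ε := by positivity
  have hεM2 : ε * M ^ 2 = 1 / 16 := by rw [hε_def]; field_simp
  have hε1 : ε ≤ 1 / 16 := by rw [← hεM2]; exact le_mul_of_one_le_right hε.le hM2
  have hεM : ε * M ≤ 1 / 16 := by
    rw [← hεM2]; gcongr; nlinarith
  set κ := ε * lam / 2 with hκ_def
  have hκ : 0 < κ := by positivity
  have hκ1 : κ ≤ 1 / 2 := by
    have := mul_le_mul hε1 hlam1 hlam.le (by norm_num)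
    linarith
  clear_value ε
  have hnear' : ∀ p, Metric.infDist (P p) Z ≤ δ → Metric.infDist (P p) Z
      ≤ C * ‖quadError β e₀ (P p)‖ := fun p hp => by
    obtain ⟨z, hz, hz'⟩ := hnear p hp
    exact (Metric.infDist_le_dist_of_mem hz).trans (by rwa [dist_eq_norm])
  have hsmall : ∀ (p : H₁) (r : ℝ), 1 / 4 * ‖quadError β e₀ (P p)‖ ^ 2 ≤ r ^ 2 / 4 → 0 ≤ r →
      ‖quadError β e₀ (P p)‖ ≤ r := fun p r h hr =>
    le_of_sq_le_sq (by linarith) hr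
  have hlow : ∀ x : H₃, 1 / 4 * ‖x‖ ^ 2 ≤ (ε + 1) / 4 * ‖x‖ ^ 2 := fun x =>
    mul_le_mul_of_nonneg_right (by linarith) (sq_nonneg _)
  -- The factor 3 in the decay estimate turns η²/48 into η²/16, giving ‖e‖ ≤ η/2: half the
  -- threshold, as the bootstrap needs. The first bound on ‖N‖ serves dissipation; the second gives
  -- ‖P‖ν ≤ γ/4, used for the asymptotic phase. The rate is κ/2 because κ is the rate of the
  -- squares.
  refine ⟨η ^ 2 / 48, by positivity, min (ε * lam / 16 / M ^ 2) (κ / (8 * (‖P‖ + 1))),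
    by positivity, ε, hε, κ / 2, by positivity, ?_, ?_, ?_⟩
  · calc ‖P‖ * min (ε * lam / 16 / M ^ 2) (κ / (8 * (‖P‖ + 1)))
        ≤ (‖P‖ + 1) * (κ / (8 * (‖P‖ + 1))) := by
          gcongr
          · linarith
          · exact min_le_right _ _
      _ = κ / 2 / 4 := by field_simp; norm_num
  · intro p hp hq
    refine (hnear' p hp).trans (le_trans ?_ hCη)
    gcongr
    refine hsmall p η ?_ hη.le
    have := hlow (quadError β e₀ (P p))
    have : 0 ≤ η ^ 2 := by positivity
    linarith
  intro N hN htan T p v hsol hp0 hq0 t ht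
  have hNM : M ^ 2 * ‖N‖ ≤ ε * lam / 16 := by
    have h1 := hN.trans (min_le_left _ _)
    rw [le_div_iff₀ (by positivity)] at h1
    linarith
  have hcz : ContinuousOn (fun t => P (p t)) (Set.Icc 0 T) := fun s hs =>
    (hasDerivWithinAt_rel hsol hs).continuousWithinAt
  have hce : ContinuousOn (fun t => quadError β e₀ (P (p t))) (Set.Icc 0 T) := fun s hs =>
    (hasDerivWithinAt_quadError hβ (hasDerivWithinAt_rel hsol hs)).continuousWithinAt
  set e : ℝ → H₃ := fun t => quadError β e₀ (P (p t))
  set w : ℝ → H₁ := fun t => velErr P N (p t) (v t)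
  have hdecay : ∀ t ∈ Set.Icc 0 T,
      (∀ s ∈ Set.Icc 0 t, Metric.infDist (P (p s)) Z ≤ δ ∧ ‖e s‖ ≤ η) →
      1 / 4 * ‖e t‖ ^ 2 + 1 / 4 * ‖w t‖ ^ 2 ≤ 3 * Real.exp (-κ * t) *
        ((ε + 1) / 4 * ‖e 0‖ ^ 2 + 1 / 2 * ‖w 0‖ ^ 2) := by
    intro t ht hs
    have hb : ∀ s ∈ Set.Icc 0 t, _ := fun s hs' =>
      hbound N hNM htan (p s) (v s) (hs s hs').1 (hs s hs').2
    exact norm_sq_le_exp_of_lyapDeriv_le hβ hε.le hε1 hεM hκ.le hκ1 ht.1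
      (hsol.mono (Set.Icc_subset_Icc_right ht.2)) (fun s hs' => (hb s hs').1)
      fun s hs' => (hb s hs').2
  have hexp1 : ∀ t, 0 ≤ t → Real.exp (-κ * t) ≤ 1 := fun t ht =>
    Real.exp_le_one_iff.2 (by nlinarith)
  have hq00 : 0 ≤ (ε + 1) / 4 * ‖e 0‖ ^ 2 + 1 / 2 * ‖w 0‖ ^ 2 := by positivity
  -- Closeness to the shape set and smallness of e support each other, so both are normalized and
  -- bootstrapped together, from 1 to 1/2.
  have hstay : ∀ t ∈ Set.Icc 0 T, max (Metric.infDist (P (p t)) Z / δ) (‖e t‖ / η) ≤ 1 / 2 := by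
    refine le_of_bootstrap (b := 1) (by norm_num) ?_ ?_ ?_
    · exact (((Metric.continuous_infDist_pt Z).comp_continuousOn hcz).div_const δ).sup
        (hce.norm.div_const η)
    · refine max_le ((div_le_one hδ).2 hp0) ((div_le_one hη).2 (hsmall _ η ?_ hη.le))
      have := hlow (e 0)
      have : 0 ≤ ‖w 0‖ ^ 2 := by positivity
      have : 0 ≤ η ^ 2 := by positivity
      change (ε + 1) / 4 * ‖e 0‖ ^ 2 + 1 / 2 * ‖w 0‖ ^ 2 ≤ _ at hq0
      change 1 / 4 * ‖e 0‖ ^ 2 ≤ _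
      linarith
    · intro t ht hs
      have hs' : ∀ s ∈ Set.Icc 0 t, Metric.infDist (P (p s)) Z ≤ δ ∧ ‖e s‖ ≤ η := fun s hs' => by
        have := max_le_iff.1 (hs s hs')
        exact ⟨(div_le_one hδ).1 this.1, (div_le_one hη).1 this.2⟩
      have h1 := hdecay t ht hs'
      have h2 := mul_le_mul_of_nonneg_right (hexp1 t ht.1) hq00
      change (ε + 1) / 4 * ‖e 0‖ ^ 2 + 1 / 2 * ‖w 0‖ ^ 2 ≤ _ at hq0
      have het : ‖e t‖ ≤ η / 2 := by
        refine hsmall (p t) (η / 2) ?_ (by positivity)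
        have : 0 ≤ ‖w t‖ ^ 2 := by positivity
        change 1 / 4 * ‖e t‖ ^ 2 ≤ _
        linarith
      refine max_le ?_ ?_
      · rw [div_le_iff₀ hδ]
        have h3 := hnear' (p t) (hs' t ⟨ht.1, le_rfl⟩).1
        have h4 : C * ‖e t‖ ≤ C * η := by gcongr; linarith
        change _ ≤ C * ‖e t‖ at h3
        linarith
      · rw [div_le_iff₀ hη]; linarith
  have hst : ∀ t ∈ Set.Icc 0 T, Metric.infDist (P (p t)) Z ≤ δ ∧ ‖e t‖ ≤ η := fun t ht => by
    have := max_le_iff.1 ((hstay t ht).trans (by norm_num : (1 / 2 : ℝ) ≤ 1))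
    exact ⟨(div_le_one hδ).1 this.1, (div_le_one hη).1 this.2⟩
  refine ⟨(hst t ht).1, ?_⟩
  have h1 := hdecay t ht fun s hs => hst s ⟨hs.1, hs.2.trans ht.2⟩
  change ‖e t‖ + ‖w t‖ ≤ 5 * Real.exp (-(κ / 2) * t) * (‖e 0‖ + ‖w 0‖)
  have hE : Real.exp (-κ * t) = Real.exp (-(κ / 2) * t) ^ 2 := by
    rw [← Real.exp_nat_mul]; congr 1; push_cast; ring
  have he00 := norm_nonneg (e 0)
  have hw00 := norm_nonneg (w 0)
  have h2 : (ε + 1) / 4 * ‖e 0‖ ^ 2 + 1 / 2 * ‖w 0‖ ^ 2 ≤ 1 / 2 * (‖e 0‖ + ‖w 0‖) ^ 2 := by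
    have : (ε + 1) / 4 * ‖e 0‖ ^ 2 ≤ 1 / 2 * ‖e 0‖ ^ 2 :=
      mul_le_mul_of_nonneg_right (by linarith) (sq_nonneg _)
    nlinarith [mul_nonneg he00 hw00]
  have h3 := mul_le_mul_of_nonneg_left h2 (by positivity : 0 ≤ 3 * Real.exp (-κ * t))
  refine le_of_sq_le_sq ?_ (by positivity)
  rw [mul_pow, mul_pow, ← hE]
  have h4 : 0 ≤ Real.exp (-κ * t) * (‖e 0‖ + ‖w 0‖) ^ 2 := by positivity
  nlinarith [sq_nonneg (‖e t‖ - ‖w t‖)]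

end

/-! ### Linear flows and asymptotic phase -/

theorem exp_zero_smul_apply {E : Type*} [NormedAddCommGroup E] [NormedSpace ℝ E] (M : E →L[ℝ] E)
    (x : E) :
    NormedSpace.exp ((0 : ℝ) • M) x = x := by simp

section

variable {E : Type*} [NormedAddCommGroup E] [NormedSpace ℝ E] [CompleteSpace E]

theorem hasDerivAt_exp_smul_apply (M : E →L[ℝ] E) (x : E) (t : ℝ) :
    HasDerivAt (fun s : ℝ => NormedSpace.exp (s • M) x) (M (NormedSpace.exp (t • M) x)) t :=
  (hasDerivAt_exp_smul_const' M t).clm_apply (hasDerivAt_const t x) |>.congr_deriv (by simp)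

theorem norm_exp_smul_apply_le (M : E →L[ℝ] E) (x : E) {t : ℝ} (ht : 0 ≤ t) :
    ‖NormedSpace.exp (t • M) x‖ ≤ ‖x‖ * Real.exp (‖M‖ * t) := by
  have h := norm_le_gronwallBound_of_norm_deriv_right_le (δ := ‖x‖) (K := ‖M‖) (ε := 0) (a := 0)
    (b := t) (fun s _ => (hasDerivAt_exp_smul_apply M x s).continuousAt.continuousWithinAt)
    (fun s _ => (hasDerivAt_exp_smul_apply M x s).hasDerivWithinAt) (by simp)
    (fun s _ => by rw [add_zero]; exact M.le_opNorm _) t ⟨ht, le_rfl⟩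
  simpa [gronwallBound_ε0] using h

theorem exp_smul_exp_neg_smul_apply (M : E →L[ℝ] E) (x : E) (t : ℝ) :
    NormedSpace.exp (t • M) (NormedSpace.exp (t • -M) x) = x := by
  have h : NormedSpace.exp (t • M) * NormedSpace.exp (t • -M) = 1 := by
    let _ := NormedAlgebra.restrictScalars ℚ ℝ (E →L[ℝ] E)
    rw [← NormedSpace.exp_add_of_commute (by
      exact ((Commute.refl M).neg_right.smul_right t).smul_left t)]
    simp
  exact congrArg (fun L : E →L[ℝ] E => L x) h

theorem tendsto_const_mul_exp_neg {D κ : ℝ} (hκ : 0 < κ) :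
    Tendsto (fun t : ℝ => D * Real.exp (-κ * t)) atTop (𝓝 0) := by
  have : Tendsto (fun t : ℝ => Real.exp (-κ * t)) atTop (𝓝 0) :=
    Real.tendsto_exp_atBot.comp (tendsto_id.const_mul_atTop_of_neg (by linarith))
  simpa using this.const_mul D

/-- A curve whose derivative decays exponentially converges, exponentially fast. -/
theorem exists_limit_of_deriv_exp_decay {y y' : ℝ → E} {D κ : ℝ} (hκ : 0 < κ) (hD : 0 ≤ D)
    (hy : ∀ t, 0 ≤ t → HasDerivWithinAt y (y' t) (Set.Ici 0) t)
    (hb : ∀ t, 0 ≤ t → ‖y' t‖ ≤ D * Real.exp (-κ * t)) :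
    ∃ y₀, ∀ t, 0 ≤ t → ‖y t - y₀‖ ≤ D / κ * Real.exp (-κ * t) := by
  have hdist : ∀ s t, 0 ≤ s → s ≤ t → ‖y t - y s‖ ≤ D / κ * Real.exp (-κ * s) := by
    intro s t hs hst
    have hB : ∀ x, HasDerivAt (fun x => D / κ * (Real.exp (-κ * s) - Real.exp (-κ * x)))
        (D * Real.exp (-κ * x)) x := by
      intro x
      have h1 : HasDerivAt (fun x => Real.exp (-κ * x)) (Real.exp (-κ * x) * -κ) x := by
        simpa using ((hasDerivAt_id x).const_mul (-κ)).exp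
      refine ((h1.const_sub _).const_mul (D / κ)).congr_deriv ?_
      field_simp
    have h := image_norm_le_of_norm_deriv_right_le_deriv_boundary (f := fun x => y x - y s)
      (f' := y') (a := s) (b := t)
      (fun x hx => (((hy x (hs.trans hx.1)).continuousWithinAt).mono
        (fun u hu => hs.trans hu.1)).sub continuousWithinAt_const)
      (fun x hx => ((hy x (hs.trans hx.1)).mono (Set.Ici_subset_Ici.2 (hs.trans hx.1))).sub_const _)
      (by simp) hB (fun x hx => hb x (hs.trans hx.1)) ⟨hst, le_rfl⟩
    refine h.trans ?_
    gcongr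
    linarith [Real.exp_pos (-κ * t)]
  have hlim : Tendsto (fun n : ℕ => 2 * (D / κ) * Real.exp (-κ * n)) atTop (𝓝 0) :=
    (tendsto_const_mul_exp_neg hκ).comp tendsto_natCast_atTop_atTop
  have hcau : CauchySeq fun n : ℕ => y n := by
    refine cauchySeq_of_le_tendsto_0 _ (fun n m K hn hm => ?_) hlim
    have h1 := hdist K n (by positivity) (by exact_mod_cast hn)
    have h2 := hdist K m (by positivity) (by exact_mod_cast hm)
    calc dist (y n) (y m) ≤ dist (y n) (y K) + dist (y m) (y K) := dist_triangle_right _ _ _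
      _ ≤ _ := by rw [dist_eq_norm, dist_eq_norm]; linarith
  obtain ⟨y₀, hy₀⟩ := cauchySeq_tendsto_of_complete hcau
  refine ⟨y₀, fun t ht => ?_⟩
  rw [norm_sub_rev]
  refine le_of_tendsto ((hy₀.sub_const (y t)).norm) ?_
  filter_upwards [eventually_ge_atTop ⌈t⌉₊] with n hn
  exact hdist t n ht ((Nat.le_ceil t).trans (by exact_mod_cast hn))

/-- Asymptotic phase: a curve that approaches a set invariant under a linear flow, and solves the
linear equation up to a perturbation, is asymptotic to one orbit in the set, if the decay is faster
than the expansion rate of the flow. -/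
theorem exists_asymptotic_orbit {Z : Set E} (hZ : IsClosed Z) {M : E →L[ℝ] E} {D γ : ℝ}
    (hD : 0 ≤ D) (hγ : 0 < γ) (hM : 2 * ‖M‖ < γ)
    (hinv : ∀ t : ℝ, ∀ x ∈ Z, NormedSpace.exp (t • M) x ∈ Z) {z d : ℝ → E}
    (hz : ∀ t, 0 ≤ t → HasDerivWithinAt z (M (z t) + d t) (Set.Ici 0) t)
    (hd : ∀ t, 0 ≤ t → ‖d t‖ ≤ D * Real.exp (-γ * t))
    (hnear : ∀ t, 0 ≤ t → ∃ x ∈ Z, ‖z t - x‖ ≤ D * Real.exp (-γ * t)) :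
    ∃ y ∈ Z, Tendsto (fun t : ℝ => z t - NormedSpace.exp (t • M) y) atTop (𝓝 0) := by
  set κ := γ - ‖M‖ with hκ_def
  have hM0 := norm_nonneg M
  have hκ : 0 < κ := by linarith
  have hback : ∀ (t : ℝ) (x : E), 0 ≤ t → ‖x‖ ≤ D * Real.exp (-γ * t) →
      ‖NormedSpace.exp (t • -M) x‖ ≤ D * Real.exp (-κ * t) := by
    intro t x ht hx
    refine (norm_exp_smul_apply_le (-M) x ht).trans ?_
    rw [norm_neg]
    calc ‖x‖ * Real.exp (‖M‖ * t) ≤ D * Real.exp (-γ * t) * Real.exp (‖M‖ * t) := by gcongr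
      _ = D * Real.exp (-κ * t) := by
        rw [mul_assoc, ← Real.exp_add]; congr 2; rw [hκ_def]; ring
  -- Pulling z back by the flow cancels the linear part, leaving the pulled-back perturbation, which
  -- still decays at rate γ - ‖M‖.
  have hy : ∀ t, 0 ≤ t → HasDerivWithinAt (fun t : ℝ => NormedSpace.exp (t • -M) (z t))
      (NormedSpace.exp (t • -M) (d t)) (Set.Ici 0) t := by
    intro t ht
    have h1 := (hasDerivAt_exp_smul_const (𝕂 := ℝ) (-M) t).hasDerivWithinAt (s := Set.Ici 0)
    refine (h1.clm_apply (hz t ht)).congr_deriv ?_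
    simp
  obtain ⟨y₀, hy₀⟩ := exists_limit_of_deriv_exp_decay hκ hD hy
    fun t ht => hback t _ ht (hd t ht)
  refine ⟨y₀, ?_, ?_⟩
  -- The pulled-back shape points remain in `Z` by invariance and have the same limit, so closedness
  -- places the limit in `Z`.
  · choose! x hxZ hx using hnear
    have hlim : Tendsto (fun n : ℕ => NormedSpace.exp ((n : ℝ) • -M) (x n)) atTop (𝓝 y₀) := by
      rw [tendsto_iff_norm_sub_tendsto_zero]
      refine squeeze_zero (fun _ => norm_nonneg _) (fun n => ?_)
        (((tendsto_const_mul_exp_neg (D := D + D / κ) hκ)).comp tendsto_natCast_atTop_atTop)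
      have hn : (0 : ℝ) ≤ n := by positivity
      have h1 := hback n _ hn (hx n hn)
      have h2 := hy₀ n hn
      calc ‖NormedSpace.exp ((n : ℝ) • -M) (x n) - y₀‖
          = ‖(NormedSpace.exp ((n : ℝ) • -M) (z n) - y₀)
              - NormedSpace.exp ((n : ℝ) • -M) (z n - x n)‖ := by
            rw [map_sub]; congr 1; abel
        _ ≤ D / κ * Real.exp (-κ * n) + D * Real.exp (-κ * n) :=
            (norm_sub_le _ _).trans (add_le_add h2 h1)
        _ = (D + D / κ) * Real.exp (-κ * n) := by ring
    refine hZ.mem_of_tendsto hlim (Eventually.of_forall fun n => ?_)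
    have := hinv (-n) (x n) (hxZ n (by positivity))
    rwa [neg_smul, ← smul_neg] at this
  -- Pushing forward costs a second factor exp(‖M‖ t); the remaining rate γ - 2‖M‖ is positive by
  -- `hM`.
  · rw [tendsto_zero_iff_norm_tendsto_zero]
    refine squeeze_zero' (Eventually.of_forall fun _ => norm_nonneg _) ?_
      (tendsto_const_mul_exp_neg (D := D / κ) (κ := κ - ‖M‖) (by linarith))
    filter_upwards [eventually_ge_atTop 0] with t ht
    have h1 : z t - NormedSpace.exp (t • M) y₀
        = NormedSpace.exp (t • M) (NormedSpace.exp (t • -M) (z t) - y₀) := by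
      rw [map_sub, exp_smul_exp_neg_smul_apply]
    rw [h1]
    calc _ ≤ _ := norm_exp_smul_apply_le M _ ht
      _ ≤ D / κ * Real.exp (-κ * t) * Real.exp (‖M‖ * t) := by gcongr; exact hy₀ t ht
      _ = D / κ * Real.exp (-(κ - ‖M‖) * t) := by
        rw [mul_assoc, ← Real.exp_add]; congr 2; ring

/-- Precomposing with a retraction makes the integrand continuous on the whole line, so compact
intervals and half-lines are treated alike. -/
theorem exists_antideriv_of_retraction {S : Set ℝ} {r : ℝ → ℝ} (hr : Continuous r)
    (hrS : ∀ t, r t ∈ S) (hid : ∀ t ∈ S, r t = t) {v : ℝ → E} (hv : ContinuousOn v S) (p₀ : E) :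
    ∃ p : ℝ → E, p 0 = p₀ ∧ ∀ t ∈ S, HasDerivWithinAt p (v t) S t := by
  have hc : Continuous (v ∘ r) := hv.comp_continuous hr hrS
  refine ⟨fun t => p₀ + ∫ s in (0 : ℝ)..t, (v ∘ r) s, by simp, fun t ht => ?_⟩
  have h := (hc.integral_hasStrictDerivAt 0 t).hasDerivAt.hasDerivWithinAt (s := S)
  refine (h.const_add p₀).congr_deriv ?_
  simp [hid t ht]

end

theorem eq_of_hasDerivWithinAt_eq {E : Type*} [NormedAddCommGroup E] [NormedSpace ℝ E] {f g f' : ℝ → E} {S : Set ℝ} {T : ℝ} (hS : Set.Icc 0 T ⊆ S)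
    (hT : 0 ≤ T) (hf : ∀ t ∈ S, HasDerivWithinAt f (f' t) S t)
    (hg : ∀ t ∈ S, HasDerivWithinAt g (f' t) S t) (h0 : f 0 = g 0) : f T = g T := by
  have h : ∀ t ∈ Set.Icc 0 T, HasDerivWithinAt (fun t => f t - g t) 0 (Set.Icc 0 T) t :=
    fun t ht => (((hf t (hS ht)).sub (hg t (hS ht))).mono hS).congr_deriv (sub_self _)
  have := constant_of_has_deriv_right_zero (fun t ht => (h t ht).continuousWithinAt)
    (fun t ht => (h t (Set.Ico_subset_Icc_self ht)).mono_of_mem_nhdsWithin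
      (mem_of_superset (Icc_mem_nhdsGE ht.2) (Set.Icc_subset_Icc_left ht.1))) T ⟨hT, le_rfl⟩
  rwa [h0, sub_self, sub_eq_zero] at this

/-! ### Global existence for the closed loop -/

section

open ContinuousLinearMap

variable {H₁ H₂ H₃ : Type*} [NormedAddCommGroup H₁] [InnerProductSpace ℝ H₁]
  [NormedAddCommGroup H₂] [InnerProductSpace ℝ H₂]
  [NormedAddCommGroup H₃] [InnerProductSpace ℝ H₃]
  [FiniteDimensional ℝ H₂] [FiniteDimensional ℝ H₃]
  [CompleteSpace H₁] [CompleteSpace H₂] [CompleteSpace H₃]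
  {P : H₁ →L[ℝ] H₂} {β : H₂ →L[ℝ] H₂ →L[ℝ] H₃} {e₀ : H₃} {N : H₂ →L[ℝ] H₁}

/-- The map `(z, y) ↦ (β(z, P ·))† y` as a continuous bilinear map. -/
noncomputable def adjointBilin (P : H₁ →L[ℝ] H₂) (β : H₂ →L[ℝ] H₂ →L[ℝ] H₃) :
    H₂ →L[ℝ] H₃ →L[ℝ] H₁ :=
  (LinearMap.mk₂ ℝ (fun z y => adjoint ((β z).comp P) y)
    (fun z z' y => by simp [add_comp]) (fun c z y => by simp [smul_comp])
    (fun z y y' => by simp) (fun c z y => by simp)).toContinuousBilinearMap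

theorem contDiff_field : ContDiff ℝ 1 fun x : H₂ × H₁ => (P x.2,
    -x.2 - adjoint ((β x.1).comp P) (quadError β e₀ x.1) + N x.1 + N (P (N x.1))) := by
  change ContDiff ℝ 1 fun x : H₂ × H₁ => (P x.2,
    -x.2 - adjointBilin P β x.1 (β x.1 x.1 - e₀) + N x.1 + N (P (N x.1)))
  have h1 : ContDiff ℝ 1 fun x : H₂ × H₁ => β x.1 x.1 := by fun_prop
  have h2 : ContDiff ℝ 1 fun x : H₂ × H₁ => adjointBilin P β x.1 (β x.1 x.1 - e₀) := by fun_prop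
  fun_prop

/-- Global existence for the closed loop, given an a priori bound on relative positions and
velocities. -/
theorem exists_isSol_Ici [FiniteDimensional ℝ H₁] (p₀ v₀ : H₁) (r : ℝ)
    (h : ∀ T, 0 ≤ T → ∀ p v : ℝ → H₁, IsSol P β e₀ N (Set.Icc 0 T) p v → p 0 = p₀ → v 0 = v₀ →
      ‖P (p T)‖ ≤ r ∧ ‖v T‖ ≤ r) :
    ∃ p v : ℝ → H₁, IsSol P β e₀ N (Set.Ici 0) p v ∧ p 0 = p₀ ∧ v 0 = v₀ := by
  -- The system is solved in (z, v), since the positions themselves may drift without bound. They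
  -- are recovered by integrating v, and P p = z because the two have the same derivative and
  -- initial value.
  let F : H₂ × H₁ → H₂ × H₁ := fun x => (P x.2,
    -x.2 - adjoint ((β x.1).comp P) (quadError β e₀ x.1) + N x.1 + N (P (N x.1)))
  have hF : ContDiff ℝ 1 F := contDiff_field
  have hlift : ∀ (S : Set ℝ) (ρ : ℝ → ℝ), Continuous ρ → (∀ t, ρ t ∈ S) → (∀ t ∈ S, ρ t = t) →
      (∀ t ∈ S, 0 ≤ t ∧ Set.Icc 0 t ⊆ S) → ∀ x : ℝ → H₂ × H₁, x 0 = (P p₀, v₀) →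
      (∀ t ∈ S, HasDerivWithinAt x (F (x t)) S t) → ∃ p : ℝ → H₁, p 0 = p₀ ∧
        IsSol P β e₀ N S p (fun t => (x t).2) ∧ ∀ t ∈ S, P (p t) = (x t).1 := by
    intro S ρ hρ hρS hid hS x hx0 hx
    have h1 : ∀ t ∈ S, HasDerivWithinAt (fun t => (x t).1) (P (x t).2) S t := fun t ht =>
      (ContinuousLinearMap.fst ℝ H₂ H₁).hasFDerivAt.comp_hasDerivWithinAt t (hx t ht)
    have h2 : ∀ t ∈ S, HasDerivWithinAt (fun t => (x t).2) (F (x t)).2 S t := fun t ht =>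
      (ContinuousLinearMap.snd ℝ H₂ H₁).hasFDerivAt.comp_hasDerivWithinAt t (hx t ht)
    obtain ⟨p, hp0, hp⟩ := exists_antideriv_of_retraction hρ hρS hid
      (fun t ht => (h2 t ht).continuousWithinAt) p₀
    have hP : ∀ t ∈ S, P (p t) = (x t).1 := fun t ht =>
      eq_of_hasDerivWithinAt_eq (f := fun t => P (p t)) (hS t ht).2 (hS t ht).1
        (fun s hs => P.hasFDerivAt.comp_hasDerivWithinAt s (hp s hs)) h1 (by simp [hp0, hx0])
    refine ⟨p, hp0, fun t ht => ⟨hp t ht, (h2 t ht).congr_deriv ?_⟩, hP⟩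
    simp [accel, hP t ht, F]
  obtain ⟨x, hx0, hx⟩ := exists_solution_of_apriori_bound hF (P p₀, v₀) r (by
    intro T hT x hx0 hx
    obtain ⟨p, hp0, hsol, hP⟩ := hlift (Set.Icc 0 T) (fun t => max 0 (min t T)) (by fun_prop)
      (fun t => ⟨le_max_left _ _, max_le hT (min_le_right _ _)⟩)
      (fun t ht => by simp [ht.1, ht.2]) (fun t ht => ⟨ht.1, Set.Icc_subset_Icc_right ht.2⟩)
      x hx0 hx
    have hTT : T ∈ Set.Icc 0 T := ⟨hT, le_rfl⟩
    obtain ⟨h1, h2⟩ := h T hT p _ hsol hp0 (by simp [hx0])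
    rw [Prod.norm_def, ← hP T hTT]
    exact max_le h1 h2)
  obtain ⟨p, hp0, hsol, -⟩ := hlift (Set.Ici 0) (fun t => max 0 t) (by fun_prop)
    (fun t => Set.mem_Ici.2 (le_max_left _ _)) (fun t ht => max_eq_right ht)
    (fun t ht => ⟨ht, Set.Icc_subset_Ici_self⟩) x hx0 hx
  exact ⟨p, _, hsol, hp0, by simp [hx0]⟩

end

/-! ### Stacked vectors, blockwise rotations and the length form -/

theorem app_mul {ι κ ν : Type} [Fintype ι] [DecidableEq ι] [Fintype κ] [DecidableEq κ] [Fintype ν]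
    (M : Matrix ν κ ℝ) (M' : Matrix κ ι ℝ) (x : EuclideanSpace ℝ ι) :
    app (M * M') x = app M (app M' x) := by
  simp [app, toLpLin_apply, Matrix.mulVec_mulVec]

/-- The common linear map `R` applied to all blocks of a stacked vector. -/
noncomputable def rot {N m : ℕ} (R : Matrix (Fin m) (Fin m) ℝ) (x : Stack N m) : Stack N m :=
  app ((1 : Matrix (Fin N) (Fin N) ℝ) ⊗ₖ R) x

theorem rot_apply {N m : ℕ} (R : Matrix (Fin m) (Fin m) ℝ) (x : Stack N m) (i : Fin N)
    (a : Fin m) : rot R x (i, a) = ∑ b, R a b * x (i, b) := by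
  simp [rot, app, toLpLin_apply, Matrix.mulVec, dotProduct, Fintype.sum_prod_type,
    Matrix.kroneckerMap_apply, Matrix.one_apply, ite_mul]

theorem rot_mul {N m : ℕ} (R S : Matrix (Fin m) (Fin m) ℝ) (x : Stack N m) :
    rot (R * S) x = rot R (rot S x) := by
  rw [rot, rot, rot, ← app_mul, ← Matrix.mul_kronecker_mul, one_mul]

@[simp]
theorem rot_one {N m : ℕ} (x : Stack N m) : rot 1 x = x := by
  simp [rot, app]

/-- `rot R x` as a bilinear map. -/
noncomputable def rotLin (N m : ℕ) : Matrix (Fin m) (Fin m) ℝ →ₗ[ℝ] Stack N m →ₗ[ℝ] Stack N m :=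
  LinearMap.mk₂ ℝ rot
    (fun R S x => by simp [rot, app, Matrix.kronecker_add])
    (fun c R x => by simp [rot, app, Matrix.kronecker_smul])
    (fun R x y => by simp [rot]) (fun c R x => by simp [rot])

@[simp]
theorem rotLin_apply {N m : ℕ} (R : Matrix (Fin m) (Fin m) ℝ) (x : Stack N m) :
    rotLin N m R x = rot R x := rfl

theorem app_bar_rot {N M m : ℕ} (A : Matrix (Fin N) (Fin M) ℝ) (R : Matrix (Fin m) (Fin m) ℝ)
    (x : Stack M m) : app (bar m A) (rot R x) = rot R (app (bar m A) x) := by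
  rw [rot, rot, ← app_mul, ← app_mul, bar, ← Matrix.mul_kronecker_mul, ← Matrix.mul_kronecker_mul]
  simp

theorem bar_transpose {N M : ℕ} (m : ℕ) (A : Matrix (Fin N) (Fin M) ℝ) :
    (bar m A)ᵀ = bar m Aᵀ := by
  ext ⟨i, a⟩ ⟨j, b⟩
  simp [bar, Matrix.one_apply, eq_comm]

theorem app_D_transpose_apply {l m : ℕ} (x y : Stack l m) (k : Fin l) :
    app (D x)ᵀ y k = ∑ a, x (k, a) * y (k, a) := by
  simp only [app, toLpLin_apply, Matrix.mulVec, dotProduct, D, Fintype.sum_prod_type,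
    Matrix.transpose_apply, Matrix.of_apply, ite_mul, zero_mul]
  rw [Finset.sum_comm]
  simp

/-- The bilinear form with components `⟪x_k, y_k⟫`. -/
noncomputable def lenForm (l m : ℕ) : Stack l m →L[ℝ] Stack l m →L[ℝ] EuclideanSpace ℝ (Fin l) :=
  (LinearMap.mk₂ ℝ (fun x y : Stack l m => app (D x)ᵀ y)
    (fun x x' y => by
      ext k; simp [app_D_transpose_apply, add_mul, Finset.sum_add_distrib])
    (fun c x y => by
      ext k; simp [app_D_transpose_apply, mul_assoc, Finset.mul_sum])
    (fun x y y' => by simp) (fun c x y => by simp)).toContinuousBilinearMap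

theorem lenForm_eq_app {l m : ℕ} (x y : Stack l m) : lenForm l m x y = app (D x)ᵀ y := rfl

theorem lenForm_apply {l m : ℕ} (x y : Stack l m) (k : Fin l) :
    lenForm l m x y k = ∑ a, x (k, a) * y (k, a) := by
  rw [lenForm_eq_app, app_D_transpose_apply]

theorem lenForm_comm {l m : ℕ} (x y : Stack l m) : lenForm l m x y = lenForm l m y x := by
  ext k; simp [lenForm_apply, mul_comm]

theorem lenForm_rot {l m : ℕ} {R : Matrix (Fin m) (Fin m) ℝ} (hR : Rᵀ * R = 1) (x y : Stack l m) :
    lenForm l m (rot R x) (rot R y) = lenForm l m x y := by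
  ext k
  have h : ∀ z : Stack l m, (fun a => rot R z (k, a)) = R *ᵥ fun a => z (k, a) := fun z => by
    ext a; simp [rot_apply, Matrix.mulVec, dotProduct]
  have h2 := congrArg₂ dotProduct (h x) (h y)
  rw [Matrix.dotProduct_mulVec, Matrix.vecMul_mulVec, hR,
    Matrix.vecMul_one] at h2
  simpa [lenForm_apply, dotProduct] using h2

theorem lenForm_rot_skew {l m : ℕ} {W : Matrix (Fin m) (Fin m) ℝ} (hW : Wᵀ = -W) (x : Stack l m) :
    lenForm l m x (rot W x) = 0 := by
  ext k
  have h : (fun a => rot W x (k, a)) = W *ᵥ fun a => x (k, a) := by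
    ext a; simp [rot_apply, Matrix.mulVec, dotProduct]
  have h2 : (fun a => x (k, a)) ⬝ᵥ (W *ᵥ fun a => x (k, a)) =
      -((fun a => x (k, a)) ⬝ᵥ (W *ᵥ fun a => x (k, a))) := by
    conv_lhs => rw [Matrix.dotProduct_mulVec, dotProduct_comm, ← Matrix.mulVec_transpose, hW,
      Matrix.neg_mulVec, dotProduct_neg]
  have h3 : lenForm l m x (rot W x) k = (fun a => x (k, a)) ⬝ᵥ (W *ᵥ fun a => x (k, a)) := by
    rw [lenForm_apply, ← h]; rfl
  rw [h3]; simp only [PiLp.zero_apply]; linarith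

theorem inner_eq_sum_lenForm {l m : ℕ} (x y : Stack l m) :
    inner ℝ x y = ∑ k, lenForm l m x y k := by
  simp [PiLp.inner_apply, lenForm_apply, Fintype.sum_prod_type, mul_comm]

theorem norm_rot {N m : ℕ} {R : Matrix (Fin m) (Fin m) ℝ} (hR : Rᵀ * R = 1) (x : Stack N m) :
    ‖rot R x‖ = ‖x‖ := by
  rw [norm_eq_sqrt_real_inner, norm_eq_sqrt_real_inner, inner_eq_sum_lenForm, inner_eq_sum_lenForm,
    lenForm_rot hR]

theorem distError_eq {l m : ℕ} (zs z : Stack l m) :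
    distError zs z = quadError (lenForm l m) (lenForm l m zs zs) z := by
  have h : ∀ (x : Stack l m) k, ‖block x k‖ ^ 2 = lenForm l m x x k := fun x k => by
    rw [EuclideanSpace.norm_sq_eq]; simp [lenForm_apply, block, ← sq]
  ext k
  simp [distError, quadError, h]

/-! ### The formation in abstract form, and infinitesimal rigidity -/

namespace SensingGraph

variable {n l m : ℕ} (G : SensingGraph n l)

/-- The relative position map as a continuous linear map. -/
noncomputable def relL (m : ℕ) : Stack n m →L[ℝ] Stack l m :=
  (toEuclideanLin (bar m G.B)ᵀ).toContinuousLinearMap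

theorem relL_apply (p : Stack n m) : G.relL m p = G.rel p := rfl

/-- The map `z ↦ Ā_v z` as a continuous linear map. -/
noncomputable def avL (m : ℕ) (θ : Params l) : Stack l m →L[ℝ] Stack n m :=
  (toEuclideanLin (bar m (G.Av θ))).toContinuousLinearMap

theorem avL_apply (θ : Params l) (z : Stack l m) : G.avL m θ z = app (bar m (G.Av θ)) z := rfl

theorem rel_coord (p : Stack n m) (k : Fin l) (a : Fin m) :
    G.rel p (k, a) = p (G.tail k, a) - p (G.head k, a) := by
  have h : ∀ i, G.B i k = (if i = G.tail k then 1 else 0) - (if i = G.head k then 1 else 0) := by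
    intro i
    have := G.tail_ne_head k
    simp only [B, Matrix.of_apply]
    split_ifs with h1 h2
    · exact absurd (h1.symm.trans h2) this
    all_goals simp
  simp [rel, app, toLpLin_apply, Matrix.mulVec, dotProduct, bar, Fintype.sum_prod_type,
    Matrix.kroneckerMap_apply, Matrix.one_apply, h, sub_mul, ite_mul, Finset.sum_sub_distrib]

theorem rel_rot (R : Matrix (Fin m) (Fin m) ℝ) (p : Stack n m) :
    G.rel (rot R p) = rot R (G.rel p) := by
  rw [rel, rel, bar_transpose, app_bar_rot]

theorem rigidityMatrix_apply (z : Stack l m) (p : Stack n m) :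
    app (G.rigidityMatrix z) p = lenForm l m z (G.rel p) := by
  rw [rigidityMatrix, app_mul]; rfl

theorem adjoint_lenForm_relL (z : Stack l m) (y : EuclideanSpace ℝ (Fin l)) :
    ContinuousLinearMap.adjoint ((lenForm l m z).comp (G.relL m)) y
      = app (bar m G.B * D z) y := by
  refine ext_inner_right ℝ fun x => ?_
  rw [ContinuousLinearMap.adjoint_inner_left]
  have h : app (bar m G.B * D z) y = (toEuclideanLin (G.rigidityMatrix z)).adjoint y := by
    rw [← Matrix.toEuclideanLin_conjTranspose_eq_adjoint, Matrix.conjTranspose_eq_transpose_of_trivial,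
      rigidityMatrix, Matrix.transpose_mul, Matrix.transpose_transpose, Matrix.transpose_transpose]
  rw [h, LinearMap.adjoint_inner_left]
  congr 1
  exact (G.rigidityMatrix_apply z x).symm

/-- With c₁ = 1 the matrix A is A_v + A_v Bᵀ A_v, which acts on z as N + N P N; the shape term is
the adjoint of the rigidity matrix applied to e. -/
theorem control_eq_accel (zs : Stack l m) (θ : Params l) (p v : Stack n m) :
    G.control zs 1 1 θ p v
      = accel (G.relL m) (lenForm l m) (lenForm l m zs zs) (G.avL m θ) p v := by
  rw [control, accel, adjoint_lenForm_relL, ← distError_eq, relL_apply, avL_apply, avL_apply,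
    relL_apply]
  have hA : bar m (G.A 1 θ) = bar m (G.Av θ) + bar m (G.Av θ) * ((bar m G.B)ᵀ * bar m (G.Av θ)) := by
    rw [A, Aa, one_smul, bar_transpose]
    simp [bar, Matrix.add_kronecker, ← Matrix.mul_kronecker_mul, Matrix.mul_assoc]
  have h2 : app (bar m (G.A 1 θ)) (G.rel p) = app (bar m (G.Av θ)) (G.rel p)
      + app (bar m (G.Av θ)) (G.rel (app (bar m (G.Av θ)) (G.rel p))) := by
    rw [hA, app, map_add, LinearMap.add_apply]
    congr 1
    rw [← app, app_mul, app_mul]; rfl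
  rw [h2, one_smul, one_smul, add_assoc]

theorem isSolution_iff (zs : Stack l m) (θ : Params l) (p v : ℝ → Stack n m) :
    G.IsSolution zs 1 1 θ p v ↔
      IsSol (G.relL m) (lenForm l m) (lenForm l m zs zs) (G.avL m θ) (Set.Ici 0) p v := by
  simp only [IsSolution, IsSol, control_eq_accel, Set.mem_Ici]

theorem velError_eq (θ : Params l) (p v : Stack n m) :
    G.velError θ p v = velErr (G.relL m) (G.avL m θ) p v := rfl

/-- Minimality makes the rank equal to the number of edges, so the rigidity matrix has full row
rank. -/
theorem InfMinRigid.surjective {G : SensingGraph n l} {ps : Stack n m} (hG : G.InfMinRigid ps) :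
    Function.Surjective fun p : Stack n m => lenForm l m (G.rel ps) (G.rel p) := by
  have hrank : (G.rigidityMatrix (G.rel ps)).rank = l := by
    rcases hG with ⟨h1 | h1, h2 | h2⟩ <;> omega
  have h : LinearMap.range (G.rigidityMatrix (G.rel ps)).mulVecLin = ⊤ := by
    apply Submodule.eq_top_of_finrank_eq
    rw [← Matrix.rank, hrank]; simp
  intro y
  obtain ⟨x, hx⟩ := LinearMap.range_eq_top.1 h y.ofLp
  refine ⟨WithLp.toLp 2 x, ?_⟩
  refine (G.rigidityMatrix_apply _ _).symm.trans ?_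
  ext k
  exact congrFun hx k

/-- The stacked vector with all blocks equal. -/
noncomputable def transl (n m : ℕ) : (Fin m → ℝ) →ₗ[ℝ] Stack n m where
  toFun τ := WithLp.toLp 2 fun i => τ i.2
  map_add' _ _ := rfl
  map_smul' _ _ := rfl

@[simp]
theorem transl_apply (τ : Fin m → ℝ) (x : Fin n × Fin m) : transl n m τ x = τ x.2 := rfl

theorem rel_transl (τ : Fin m → ℝ) : G.rel (transl n m τ) = 0 := by
  ext ⟨k, a⟩
  rw [rel_coord]; simp

/-- Dimension count: if a linear family of skew matrices acts faithfully on the relative positions,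
and its dimension complements the rank of the rigidity matrix, then it accounts for all
infinitesimal motions preserving the lengths. -/
theorem exists_rel_eq_rot_of_finrank {ps : Stack n m} (hn : 0 < n) {d : ℕ}
    (hsurj : Function.Surjective fun p : Stack n m => lenForm l m (G.rel ps) (G.rel p))
    (j : (Fin d → ℝ) →ₗ[ℝ] Matrix (Fin m) (Fin m) ℝ) (hj : ∀ w, (j w)ᵀ = -j w)
    (hinj : ∀ w, rot (j w) (G.rel ps) = 0 → w = 0) (hdim : n * m = l + (m + d))
    {p : Stack n m} (hp : lenForm l m (G.rel ps) (G.rel p) = 0) :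
    ∃ w, G.rel p = rot (j w) (G.rel ps) := by
  let R : Stack n m →ₗ[ℝ] EuclideanSpace ℝ (Fin l) :=
    ((lenForm l m (G.rel ps)).comp (G.relL m)).toLinearMap
  have hR : ∀ q, R q = lenForm l m (G.rel ps) (G.rel q) := fun _ => rfl
  have hker : Module.finrank ℝ (LinearMap.ker R) = m + d := by
    have h1 := R.finrank_range_add_finrank_ker
    rw [LinearMap.range_eq_top.2 hsurj, finrank_top] at h1
    simp only [finrank_euclideanSpace, Fintype.card_prod, Fintype.card_fin] at h1
    omega
  let Ψ : ((Fin m → ℝ) × (Fin d → ℝ)) →ₗ[ℝ] Stack n m :=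
    (transl n m).coprod (((rotLin n m).flip ps).comp j)
  have hΨ : ∀ τ w, Ψ (τ, w) = transl n m τ + rot (j w) ps := fun _ _ => rfl
  have hrel : ∀ τ w, G.rel (Ψ (τ, w)) = rot (j w) (G.rel ps) := fun τ w => by
    rw [hΨ, ← relL_apply, map_add, relL_apply, relL_apply, rel_transl, zero_add, rel_rot]
  -- Relative positions do not see translations, so faithfulness kills the rotational part first;
  -- the first agent then reads off the translation.
  have hΨinj : Function.Injective Ψ := by
    rw [← LinearMap.ker_eq_bot, LinearMap.ker_eq_bot']
    rintro ⟨τ, w⟩ h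
    have hw : w = 0 := hinj w (by rw [← hrel τ w, h, ← relL_apply, map_zero])
    subst hw
    have hτ : τ = 0 := by
      funext a
      have := congrArg (fun x : Stack n m => x (⟨0, hn⟩, a)) h
      simpa [hΨ, rot_apply] using this
    rw [hτ]; rfl
  have hle : LinearMap.range Ψ ≤ LinearMap.ker R := by
    rintro _ ⟨⟨τ, w⟩, rfl⟩
    rw [LinearMap.mem_ker, hR, hrel, lenForm_rot_skew (hj w)]
  have heq : LinearMap.range Ψ = LinearMap.ker R := by
    refine Submodule.eq_of_le_of_finrank_eq hle ?_
    rw [hker, LinearMap.finrank_range_of_inj hΨinj]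
    simp
  have hp' : p ∈ LinearMap.range Ψ := by rw [heq]; exact hp
  obtain ⟨⟨τ, w⟩, rfl⟩ := hp'
  exact ⟨w, hrel τ w⟩

/-- Skew-symmetric matrices in the plane. -/
def skewTwo : (Fin 1 → ℝ) →ₗ[ℝ] Matrix (Fin 2) (Fin 2) ℝ where
  toFun w := !![0, -w 0; w 0, 0]
  map_add' w w' := by ext i j; fin_cases i <;> fin_cases j <;> simp [add_comm]
  map_smul' c w := by ext i j; fin_cases i <;> fin_cases j <;> simp

/-- Skew-symmetric matrices in space, acting as the cross product with a vector. -/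
def skewThree : (Fin 3 → ℝ) →ₗ[ℝ] Matrix (Fin 3) (Fin 3) ℝ where
  toFun w := !![0, -w 2, w 1; w 2, 0, -w 0; -w 1, w 0, 0]
  map_add' w w' := by ext i j; fin_cases i <;> fin_cases j <;> simp [add_comm]
  map_smul' c w := by ext i j; fin_cases i <;> fin_cases j <;> simp

/-- If the rigidity matrix is onto and all relative positions in space are parallel to one
direction, then there are fewer edges than agents. -/
theorem card_edges_lt_of_collinear {ps : Stack n 3} (hn : 0 < n)
    (hsurj : Function.Surjective fun p : Stack n 3 => lenForm l 3 (G.rel ps) (G.rel p))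
    {w : Fin 3 → ℝ} (hw : w ≠ 0) (h : rot (skewThree w) (G.rel ps) = 0) : l + 1 ≤ n := by
  set z := G.rel ps
  have hcross : ∀ k, z (k, 0) * w 1 = z (k, 1) * w 0 ∧ z (k, 1) * w 2 = z (k, 2) * w 1 ∧
      z (k, 0) * w 2 = z (k, 2) * w 0 := by
    intro k
    have h0 := congrArg (fun x : Stack l 3 => x (k, 0)) h
    have h1 := congrArg (fun x : Stack l 3 => x (k, 1)) h
    have h2 := congrArg (fun x : Stack l 3 => x (k, 2)) h
    simp [rot_apply, skewThree, Fin.sum_univ_three] at h0 h1 h2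
    refine ⟨?_, ?_, ?_⟩ <;> linarith
  have hw2 : w 0 * w 0 + w 1 * w 1 + w 2 * w 2 ≠ 0 := by
    contrapose! hw
    funext i
    fin_cases i <;> simp <;> nlinarith [sq_nonneg (w 0), sq_nonneg (w 1), sq_nonneg (w 2)]
  set c : Fin l → ℝ := fun k => (w 0 * z (k, 0) + w 1 * z (k, 1) + w 2 * z (k, 2)) /
    (w 0 * w 0 + w 1 * w 1 + w 2 * w 2)
  have hz : ∀ k a, z (k, a) = c k * w a := by
    intro k a
    obtain ⟨h1, h2, h3⟩ := hcross k
    simp only [c]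
    rw [div_mul_eq_mul_div, eq_div_iff hw2]
    fin_cases a <;> simp
    · linear_combination w 1 * h1 + w 2 * h3
    · linear_combination -w 0 * h1 + w 2 * h2
    · linear_combination -w 0 * h3 - w 1 * h2
  -- When every z_k is a multiple of w, the rigidity matrix sees only the scalars ⟨w, p_i⟩. Its
  -- surjectivity therefore passes to a map from ℝⁿ that kills the constants.
  let Θ : (Fin n → ℝ) →ₗ[ℝ] (Fin l → ℝ) :=
    { toFun := fun q k => c k * (q (G.tail k) - q (G.head k))
      map_add' := fun q q' => by funext k; simp; ring
      map_smul' := fun r q => by funext k; simp; ring }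
  have hΘ : Function.Surjective Θ := by
    intro y
    obtain ⟨p, hp⟩ := hsurj (WithLp.toLp 2 y)
    refine ⟨fun i => ∑ a, w a * p (i, a), ?_⟩
    funext k
    have hk := congrArg (fun x : EuclideanSpace ℝ (Fin l) => x k) hp
    simp only [lenForm_apply, rel_coord, hz] at hk
    rw [← hk]
    simp only [Θ, LinearMap.coe_mk, AddHom.coe_mk, ← Finset.sum_sub_distrib, Finset.mul_sum]
    exact Finset.sum_congr rfl fun a _ => by ring
  have hker : 1 ≤ Module.finrank ℝ (LinearMap.ker Θ) := by
    rw [Submodule.one_le_finrank_iff, Submodule.ne_bot_iff]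
    refine ⟨fun _ => 1, by ext k; simp [Θ], fun h => ?_⟩
    exact one_ne_zero (congrFun h ⟨0, hn⟩)
  have := Θ.finrank_range_add_finrank_ker
  rw [LinearMap.range_eq_top.2 hΘ, finrank_top] at this
  simp at this
  omega

/-- The infinitesimal motions of an infinitesimally and minimally rigid framework are the rigid
ones. -/
theorem InfMinRigid.exists_skew {G : SensingGraph n l} {ps : Stack n m} (hG : G.InfMinRigid ps)
    (hn : 2 ≤ n) {p : Stack n m} (hp : lenForm l m (G.rel ps) (G.rel p) = 0) :
    ∃ W : Matrix (Fin m) (Fin m) ℝ, Wᵀ = -W ∧ G.rel p = rot W (G.rel ps) := by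
  have hsurj := hG.surjective
  rcases hG.2 with ⟨rfl, hl⟩ | ⟨rfl, hl⟩
  · have hskew : ∀ w, (skewTwo w)ᵀ = -skewTwo w := fun w => by
      ext i j; fin_cases i <;> fin_cases j <;> simp [skewTwo]
    obtain ⟨w, hw⟩ := G.exists_rel_eq_rot_of_finrank (by omega) hsurj skewTwo hskew (fun w h => by
      by_contra hw
      have hw0 : w 0 ≠ 0 := fun h0 => hw (by funext i; fin_cases i; exact h0)
      have hz : G.rel ps = 0 := by
        ext ⟨k, a⟩
        have h0 := congrArg (fun x : Stack l 2 => x (k, 0)) h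
        have h1 := congrArg (fun x : Stack l 2 => x (k, 1)) h
        simp [rot_apply, skewTwo, Fin.sum_univ_two, hw0] at h0 h1
        fin_cases a <;> simp [h0, h1]
      -- A vanishing z would make the rigidity matrix zero, although it is onto a space with at
      -- least one edge.
      obtain ⟨q, hq⟩ := hsurj (WithLp.toLp 2 fun _ => 1)
      have hk := congrArg (fun x : EuclideanSpace ℝ (Fin l) => x ⟨0, by omega⟩) hq
      simp [hz] at hk) (by omega) hp
    exact ⟨_, hskew w, hw⟩
  · rcases Nat.eq_zero_or_pos l with rfl | hl0
    · exact ⟨0, by simp, by ext ⟨k, a⟩; exact k.elim0⟩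
    have hskew : ∀ w, (skewThree w)ᵀ = -skewThree w := fun w => by
      ext i j; fin_cases i <;> fin_cases j <;> simp [skewThree]
    obtain ⟨w, hw⟩ := G.exists_rel_eq_rot_of_finrank (by omega) hsurj skewThree hskew (fun w h => by
      by_contra hw
      have := G.card_edges_lt_of_collinear (by omega) hsurj hw h
      omega) (by omega) hp
    exact ⟨_, hskew w, hw⟩

end SensingGraph

/-! ### Rotations and the shape set -/

section

attribute [local instance] Matrix.linftyOpNormedRing Matrix.linftyOpNormedAlgebra

variable {m : ℕ}

theorem transpose_mul_self_of_mem_SO {R : Matrix (Fin m) (Fin m) ℝ}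
    (hR : R ∈ Matrix.specialOrthogonalGroup (Fin m) ℝ) : Rᵀ * R = 1 := by
  have := (Matrix.mem_specialOrthogonalGroup_iff.1 hR).1
  exact (Matrix.mem_orthogonalGroup_iff' (Fin m) ℝ).1 this

theorem transpose_mem_SO {R : Matrix (Fin m) (Fin m) ℝ}
    (hR : R ∈ Matrix.specialOrthogonalGroup (Fin m) ℝ) :
    Rᵀ ∈ Matrix.specialOrthogonalGroup (Fin m) ℝ := by
  obtain ⟨h1, h2⟩ := Matrix.mem_specialOrthogonalGroup_iff.1 hR
  refine Matrix.mem_specialOrthogonalGroup_iff.2 ⟨?_, by rwa [Matrix.det_transpose]⟩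
  rw [Matrix.mem_orthogonalGroup_iff, Matrix.transpose_transpose]
  exact transpose_mul_self_of_mem_SO hR

/-- Orthogonality alone leaves the determinant ±1; writing the exponential as the square of the
orthogonal matrix exp(W/2) fixes the sign. -/
theorem exp_mem_SO_of_skew {W : Matrix (Fin m) (Fin m) ℝ} (hW : Wᵀ = -W) :
    NormedSpace.exp W ∈ Matrix.specialOrthogonalGroup (Fin m) ℝ := by
  have horth : ∀ X : Matrix (Fin m) (Fin m) ℝ, Xᵀ = -X →
      (NormedSpace.exp X)ᵀ * NormedSpace.exp X = 1 := fun X hX => by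
    rw [← Matrix.exp_transpose, hX, ← Matrix.exp_add_of_commute _ _ (Commute.refl X).neg_left]
    simp
  have hhalf : ((1 / 2 : ℝ) • W)ᵀ = -((1 / 2 : ℝ) • W) := by
    rw [Matrix.transpose_smul, hW, smul_neg]
  have hsq : NormedSpace.exp W
      = NormedSpace.exp ((1 / 2 : ℝ) • W) * NormedSpace.exp ((1 / 2 : ℝ) • W) := by
    rw [← Matrix.exp_add_of_commute _ _ (Commute.refl _), ← add_smul]
    norm_num
  refine Matrix.mem_specialOrthogonalGroup_iff.2 ⟨?_, ?_⟩
  · rw [Matrix.mem_orthogonalGroup_iff']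
    exact horth W hW
  · have := congrArg Matrix.det (horth _ hhalf)
    rw [Matrix.det_mul, Matrix.det_transpose, Matrix.det_one] at this
    rw [hsq, Matrix.det_mul, this]

theorem isCompact_SO (m : ℕ) :
    IsCompact (Matrix.specialOrthogonalGroup (Fin m) ℝ : Set (Matrix (Fin m) (Fin m) ℝ)) := by
  refine (isCompact_univ_pi fun _ : Fin m => isCompact_univ_pi fun _ : Fin m =>
    (isCompact_Icc (a := (-1 : ℝ)) (b := 1))).of_isClosed_subset ?_ ?_
  · have : (Matrix.specialOrthogonalGroup (Fin m) ℝ : Set (Matrix (Fin m) (Fin m) ℝ))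
        = {R | R * Rᵀ = 1} ∩ {R | R.det = 1} := by
      ext R
      rw [SetLike.mem_coe, Matrix.mem_specialOrthogonalGroup_iff, Matrix.mem_orthogonalGroup_iff]
      rfl
    rw [this]
    exact (isClosed_eq (by fun_prop) continuous_const).inter
      (isClosed_eq (by fun_prop) continuous_const)
  · intro R hR i _ j _
    have := entry_norm_bound_of_unitary (Matrix.mem_specialOrthogonalGroup_iff.1 hR).1 i j
    rw [Real.norm_eq_abs] at this
    exact abs_le.1 this

variable {N : ℕ}

/-- `R ↦ rot R x` as a continuous linear map. -/
noncomputable def orbitMap (x : Stack N m) : Matrix (Fin m) (Fin m) ℝ →L[ℝ] Stack N m :=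
  ((rotLin N m).flip x).toContinuousLinearMap

theorem hasDerivAt_rot_mul_exp (R W : Matrix (Fin m) (Fin m) ℝ) (x : Stack N m) (t : ℝ) :
    HasDerivAt (fun s : ℝ => rot (R * NormedSpace.exp (s • W)) x)
      (rot (R * NormedSpace.exp (t • W)) (rot W x)) t := by
  have h1 := (hasDerivAt_exp_smul_const (𝕂 := ℝ) W t).const_mul R
  refine ((orbitMap x).hasFDerivAt.comp_hasDerivAt t h1).congr_deriv ?_
  change rot (R * (NormedSpace.exp (t • W) * W)) x = _
  rw [← Matrix.mul_assoc, rot_mul]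

theorem shapeSet_eq_image (zs : Stack N m) :
    shapeSet zs = orbitMap zs '' (Matrix.specialOrthogonalGroup (Fin m) ℝ : Set _) := by
  ext z
  constructor
  · rintro ⟨R, hR, rfl⟩; exact ⟨R, hR, rfl⟩
  · rintro ⟨R, hR, rfl⟩; exact ⟨R, hR, rfl⟩

theorem isCompact_shapeSet (zs : Stack N m) : IsCompact (shapeSet zs) := by
  rw [shapeSet_eq_image]
  exact (isCompact_SO m).image (orbitMap zs).continuous

theorem self_mem_shapeSet (zs : Stack N m) : zs ∈ shapeSet zs :=
  ⟨1, one_mem _, (rot_one zs).symm⟩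

theorem rot_mem_shapeSet {zs : Stack N m} {R : Matrix (Fin m) (Fin m) ℝ}
    (hR : R ∈ Matrix.specialOrthogonalGroup (Fin m) ℝ) : rot R zs ∈ shapeSet zs := ⟨R, hR, rfl⟩

theorem exists_of_mem_shapeSet {zs z : Stack N m} (h : z ∈ shapeSet zs) :
    ∃ R ∈ Matrix.specialOrthogonalGroup (Fin m) ℝ, z = rot R zs := h

theorem norm_of_mem_shapeSet {zs z : Stack N m} (h : z ∈ shapeSet zs) : ‖z‖ = ‖zs‖ := by
  obtain ⟨R, hR, rfl⟩ := exists_of_mem_shapeSet h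
  exact norm_rot (transpose_mul_self_of_mem_SO hR) zs

/-- First-order optimality: the displacement from a nearest point of the shape set is orthogonal to
all infinitesimal rotations. -/
theorem inner_rot_skew_eq_zero {zs z : Stack N m} {R : Matrix (Fin m) (Fin m) ℝ}
    (hR : R ∈ Matrix.specialOrthogonalGroup (Fin m) ℝ)
    (hmin : ∀ y ∈ shapeSet zs, ‖z - rot R zs‖ ≤ ‖z - y‖) {W : Matrix (Fin m) (Fin m) ℝ}
    (hW : Wᵀ = -W) : inner ℝ (z - rot R zs) (rot R (rot W zs)) = 0 := by
  have h0 : R * NormedSpace.exp ((0 : ℝ) • W) = R := by simp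
  have hd := ((hasDerivAt_rot_mul_exp R W zs 0).const_sub z).norm_sq
  -- The curve R exp(sW) zs stays in the shape set, so the squared distance to z along it is minimal
  -- at s = 0.
  have hloc : IsLocalMin (fun s : ℝ => ‖z - rot (R * NormedSpace.exp (s • W)) zs‖ ^ 2) 0 := by
    refine Filter.Eventually.of_forall fun s => ?_
    simp only [h0]
    have hs : (s • W)ᵀ = -(s • W) := by rw [Matrix.transpose_smul, hW, smul_neg]
    gcongr
    exact hmin _ (rot_mem_shapeSet (mul_mem hR (exp_mem_SO_of_skew hs)))
  have := hloc.hasDerivAt_eq_zero hd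
  rw [h0, inner_neg_right] at this
  linarith

/-- Both sides solve x' = M x with the same initial value; equivariance moves the tangency at `zs`
to every point of the rotating curve. -/
theorem exp_rot_of_tangent {M : Stack N m →L[ℝ] Stack N m} {zs : Stack N m}
    (hM : ∀ R (x : Stack N m), M (rot R x) = rot R (M x)) {W : Matrix (Fin m) (Fin m) ℝ}
    (hMW : M zs = rot W zs) (R : Matrix (Fin m) (Fin m) ℝ) (t : ℝ) :
    NormedSpace.exp (t • M) (rot R zs) = rot (R * NormedSpace.exp (t • W)) zs := by
  have h := ODE_solution_unique_univ (v := fun _ => M) (s := fun _ => Set.univ) (K := ‖M‖₊)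
    (f := fun s : ℝ => NormedSpace.exp (s • M) (rot R zs))
    (g := fun s : ℝ => rot (R * NormedSpace.exp (s • W)) zs) (t₀ := 0)
    (fun _ => M.lipschitz.lipschitzOnWith)
    (fun s => ⟨hasDerivAt_exp_smul_apply M _ s, trivial⟩)
    (fun s => ⟨by rw [hM, hMW]; exact hasDerivAt_rot_mul_exp R W zs s, trivial⟩) (by
      have h1 : NormedSpace.exp ((0 : ℝ) • W) = 1 := by rw [zero_smul, NormedSpace.exp_zero]
      simp only [h1, mul_one]
      exact exp_zero_smul_apply M _)
  exact congrFun h t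

/-- An equivariant linear flow which is tangent to the shape set at one point preserves it. -/
theorem exp_mem_shapeSet {M : Stack N m →L[ℝ] Stack N m} {zs : Stack N m}
    (hM : ∀ R (x : Stack N m), M (rot R x) = rot R (M x)) {W : Matrix (Fin m) (Fin m) ℝ}
    (hW : Wᵀ = -W) (hMW : M zs = rot W zs) (t : ℝ) {z : Stack N m} (hz : z ∈ shapeSet zs) :
    NormedSpace.exp (t • M) z ∈ shapeSet zs := by
  obtain ⟨R, hR, rfl⟩ := exists_of_mem_shapeSet hz
  rw [exp_rot_of_tangent hM hMW]
  refine rot_mem_shapeSet (mul_mem hR (exp_mem_SO_of_skew ?_))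
  rw [Matrix.transpose_smul, hW, smul_neg]

end

/-! ### Local error bound, coercivity and designed parameters -/

namespace SensingGraph

variable {n l m : ℕ} {G : SensingGraph n l}

/-- An error bound for the shape: near the shape set, the distance to it is controlled by the
errors of the squared lengths. -/
theorem InfMinRigid.exists_near {ps : Stack n m} (hG : G.InfMinRigid ps) (hn : 2 ≤ n) :
    ∃ δ > (0 : ℝ), ∃ C ≥ (0 : ℝ), ∀ p : Stack n m,
      Metric.infDist (G.relL m p) (shapeSet (G.rel ps)) ≤ δ →
      ∃ z ∈ shapeSet (G.rel ps), ‖G.relL m p - z‖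
        ≤ C * ‖quadError (lenForm l m) (lenForm l m (G.rel ps) (G.rel ps)) (G.relL m p)‖ := by
  set zs := G.rel ps
  -- Realizable displacements orthogonal to the infinitesimal rotations of `zs`. By rigidity the
  -- linearized lengths are injective here, hence bounded below.
  let V : Submodule ℝ (Stack l m) := LinearMap.range (G.relL m).toLinearMap ⊓
    ⨅ W : {W : Matrix (Fin m) (Fin m) ℝ // Wᵀ = -W}, (Submodule.span ℝ {rot W.1 zs})ᗮ
  let Λ : V →ₗ[ℝ] EuclideanSpace ℝ (Fin l) := (lenForm l m zs).toLinearMap.domRestrict V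
  have hΛ : LinearMap.ker Λ = ⊥ := by
    rw [LinearMap.ker_eq_bot']
    rintro ⟨w, hw⟩ h
    obtain ⟨⟨p, rfl⟩, hw2⟩ := hw
    obtain ⟨W, hW, hpW⟩ := hG.exists_skew hn (p := p) h
    have h1 := (Submodule.mem_iInf _).1 hw2 ⟨W, hW⟩
    rw [Submodule.mem_orthogonal_singleton_iff_inner_right] at h1
    have h2 : (G.relL m).toLinearMap p = rot W zs := hpW
    simp only [h2, inner_self_eq_zero] at h1
    exact Subtype.ext (h2.trans h1)
  obtain ⟨K, hK0, hK⟩ := Λ.exists_antilipschitzWith hΛ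
  have hKpos : (0 : ℝ) < K := hK0
  have hlow : ∀ w ∈ V, ‖w‖ ≤ K * ‖lenForm l m zs w‖ := fun w hw => by
    have := ZeroHomClass.bound_of_antilipschitz Λ hK ⟨w, hw⟩
    exact this
  set b := ‖lenForm l m‖
  -- The error is 2β(zs, w) + β(w, w). For this radius K‖β(w, w)‖ ≤ ‖w‖, while the linear part gives
  -- 2‖w‖, so ‖w‖ ≤ K‖e‖.
  refine ⟨1 / (K * (b + 1)), by positivity, K, hKpos.le, fun p hp => ?_⟩
  obtain ⟨y, hy, hyd⟩ := (isCompact_shapeSet zs).exists_infDist_eq_dist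
    ⟨zs, self_mem_shapeSet zs⟩ (G.relL m p)
  have hmin : ∀ y' ∈ shapeSet zs, ‖G.relL m p - y‖ ≤ ‖G.relL m p - y'‖ := fun y' hy' => by
    rw [← dist_eq_norm, ← dist_eq_norm, ← hyd]
    exact Metric.infDist_le_dist_of_mem hy'
  rw [hyd, dist_eq_norm] at hp
  refine ⟨y, hy, ?_⟩
  obtain ⟨R, hR, rfl⟩ := exists_of_mem_shapeSet hy
  have hRR := transpose_mul_self_of_mem_SO hR
  have hRR' : R * Rᵀ = 1 := by simpa using transpose_mul_self_of_mem_SO (transpose_mem_SO hR)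
  -- Rotating back moves the nearest shape point to `zs`, and optimality of that point puts the
  -- displacement in `V`.
  set w := rot Rᵀ (G.rel p) - zs with hw_def
  have hwz : rot R w = G.relL m p - rot R zs := by
    rw [hw_def, ← rotLin_apply, map_sub, rotLin_apply, rotLin_apply, ← rot_mul, hRR', rot_one]
    rfl
  have hnorm : ‖G.relL m p - rot R zs‖ = ‖w‖ := by rw [← hwz, norm_rot hRR]
  have hwV : w ∈ V := by
    refine ⟨⟨rot Rᵀ p - ps, ?_⟩, ?_⟩
    · change G.relL m (rot Rᵀ p - ps) = w
      rw [map_sub, relL_apply, relL_apply, rel_rot]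
    · refine (Submodule.mem_iInf _).2 fun W => ?_
      rw [Submodule.mem_orthogonal_singleton_iff_inner_left]
      have h := inner_rot_skew_eq_zero hR hmin W.2
      rw [← hwz, inner_eq_sum_lenForm, lenForm_rot hRR, ← inner_eq_sum_lenForm] at h
      exact h
  have herr : quadError (lenForm l m) (lenForm l m zs zs) (G.relL m p)
      = (2 : ℝ) • lenForm l m zs w + lenForm l m w w := by
    have h1 : G.relL m p = rot R (zs + w) := by
      rw [hw_def, add_sub_cancel, ← rot_mul, hRR', rot_one]; rfl
    rw [quadError, h1, lenForm_rot hRR, map_add, lenForm_comm (zs + w) zs, lenForm_comm (zs + w) w,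
      map_add, map_add, lenForm_comm w zs, two_smul]
    abel
  have h1 := hlow w hwV
  have h2 : ‖lenForm l m w w‖ ≤ b * ‖w‖ * ‖w‖ := (lenForm l m).le_opNorm₂ w w
  rw [hnorm] at hp ⊢
  rw [herr]
  have h3 : ‖(2 : ℝ) • lenForm l m zs w‖ - ‖lenForm l m w w‖
      ≤ ‖(2 : ℝ) • lenForm l m zs w + lenForm l m w w‖ := norm_sub_le_norm_add _ _
  rw [norm_smul, Real.norm_two] at h3
  have hw0 := norm_nonneg w
  have hb0 : 0 ≤ b := norm_nonneg (lenForm l m)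
  have h4 : K * (b * ‖w‖ * ‖w‖) ≤ ‖w‖ := by
    have h5 : ‖w‖ * (K * (b + 1)) ≤ 1 := (le_div_iff₀ (by positivity)).1 hp
    have h6 : K * b * ‖w‖ ≤ 1 := by nlinarith
    calc K * (b * ‖w‖ * ‖w‖) = (K * b * ‖w‖) * ‖w‖ := by ring
      _ ≤ 1 * ‖w‖ := by gcongr
      _ = ‖w‖ := one_mul _
  have h7 := mul_le_mul_of_nonneg_left h3 hKpos.le
  have h8 := mul_le_mul_of_nonneg_left h2 hKpos.le
  linarith

/-- The transposed rigidity matrix is bounded below, uniformly on the shape set. -/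
theorem InfMinRigid.exists_coercive {ps : Stack n m} (hG : G.InfMinRigid ps) :
    ∃ c > (0 : ℝ), ∀ z ∈ shapeSet (G.rel ps), ∀ y, c * ‖y‖
      ≤ ‖ContinuousLinearMap.adjoint ((lenForm l m z).comp (G.relL m)) y‖ := by
  let L : Stack n m →L[ℝ] EuclideanSpace ℝ (Fin l) := (lenForm l m (G.rel ps)).comp (G.relL m)
  obtain ⟨C, hC, hL⟩ := L.exists_preimage_norm_le hG.surjective
  refine ⟨1 / C, by positivity, fun z hz y => ?_⟩
  obtain ⟨R, hR, rfl⟩ := exists_of_mem_shapeSet hz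
  have hRR := transpose_mul_self_of_mem_SO hR
  obtain ⟨x, hx, hxy⟩ := hL y
  set g := ContinuousLinearMap.adjoint ((lenForm l m (rot R (G.rel ps))).comp (G.relL m)) y
  -- Testing against the rotated preimage of y gives ‖y‖², with the same norm bound for every R;
  -- hence the constant is uniform on the shape set.
  have h1 : inner ℝ g (rot R x) = ‖y‖ ^ 2 := by
    rw [ContinuousLinearMap.adjoint_inner_left, ContinuousLinearMap.comp_apply, relL_apply,
      rel_rot, lenForm_rot hRR, ← real_inner_self_eq_norm_sq]
    congr 1
  have h2 : ‖y‖ ^ 2 ≤ ‖g‖ * (C * ‖y‖) := by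
    rw [← h1]
    refine (real_inner_le_norm _ _).trans ?_
    rw [norm_rot hRR]
    gcongr
  rcases (norm_nonneg y).eq_or_lt with h0 | h0
  · rw [← h0]; simp
  · rw [div_mul_eq_mul_div, one_mul, div_le_iff₀ hC]
    nlinarith

theorem Av_apply (θ : Params l) (i : Fin n) (k : Fin l) :
    G.Av θ i k = G.S₁ i k * θ (Sum.inl k) + G.S₂ i k * θ (Sum.inr k) := by
  have := G.tail_ne_head k
  simp only [Av, S₁, S₂, Matrix.of_apply]
  split_ifs with h1 h2
  · exact absurd (h1.symm.trans h2) this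
  all_goals simp

theorem app_T (z : Stack l m) (θ : Params l) : app (G.T z) θ = app (bar m (G.Av θ)) z := by
  ext ⟨i, a⟩
  have h : ∀ (S : Matrix (Fin n) (Fin l) ℝ) (k : Fin l),
      (bar m S * D z) (i, a) k = S i k * z (k, a) := fun S k => by
    simp [Matrix.mul_apply, bar, D, Fintype.sum_prod_type, Matrix.kroneckerMap_apply,
      Matrix.one_apply, ite_mul]
  simp only [app, toLpLin_apply, Matrix.mulVec, dotProduct, T, Fintype.sum_sum_type,
    Matrix.fromCols_apply_inl, Matrix.fromCols_apply_inr, h]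
  rw [← Finset.sum_add_distrib]
  simp only [bar, Fintype.sum_prod_type, Matrix.kroneckerMap_apply, Matrix.one_apply, Av_apply]
  refine Finset.sum_congr rfl fun k _ => ?_
  simp
  ring

theorem sub_starProjection_orthogonal_mem {E : Type*} [NormedAddCommGroup E]
    [InnerProductSpace ℝ E] [FiniteDimensional ℝ E] (K : Submodule ℝ E) (x : E) :
    x - Kᗮ.starProjection x ∈ K := by
  have := Kᗮ.sub_starProjection_mem_orthogonal x
  rwa [Submodule.orthogonal_orthogonal] at this

/-- Projecting onto the complement of Ker T subtracts an element of Ker T, which lies in the larger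
kernel anyway. -/
theorem paramsU_le (z : Stack l m) :
    G.paramsU z ≤ LinearMap.ker (toEuclideanLin ((bar m G.B)ᵀ * G.T z)) := by
  rintro _ ⟨x, hx, rfl⟩
  have h := sub_starProjection_orthogonal_mem (LinearMap.ker (toEuclideanLin (G.T z))) x
  have hle : LinearMap.ker (toEuclideanLin (G.T z))
      ≤ LinearMap.ker (toEuclideanLin ((bar m G.B)ᵀ * G.T z)) := fun y hy => by
    rw [LinearMap.mem_ker] at hy ⊢
    rw [← app, app_mul, app, app, hy, map_zero]
  have := Submodule.sub_mem _ hx (hle h)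
  simpa using this

/-- Both projections change a parameter only within Ker(Dᵀ B̄ᵀ T), so the sum stays in it. This is
how the design hypothesis enters: the prescribed velocities are infinitesimal motions of the desired
shape. -/
theorem isDesigned_tangent {z : Stack l m} {θ : Params l} (h : G.IsDesigned z θ) :
    lenForm l m z (G.rel (app (bar m (G.Av θ)) z)) = 0 := by
  have hle : LinearMap.ker (toEuclideanLin ((bar m G.B)ᵀ * G.T z))
      ≤ LinearMap.ker (toEuclideanLin ((D z)ᵀ * (bar m G.B)ᵀ * G.T z)) := fun y hy => by
    rw [LinearMap.mem_ker] at hy ⊢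
    rw [Matrix.mul_assoc, ← app, app_mul, app, app, hy, map_zero]
  obtain ⟨θv, hv, θw, ⟨x, hx, rfl⟩, rfl⟩ := h
  have hw := Submodule.sub_mem _ hx
    (hle (G.paramsU_le z (sub_starProjection_orthogonal_mem (G.paramsU z) x)))
  have hsum := Submodule.add_mem _ (hle (G.paramsU_le z hv)) hw
  rw [sub_sub_cancel] at hsum
  rw [← app_T, lenForm_eq_app, rel, ← app_mul, ← app_mul]
  exact LinearMap.mem_ker.1 hsum

/-- `Ā_v` depends linearly on the motion parameters. -/
noncomputable def avLin (m : ℕ) : Params l →ₗ[ℝ] Stack l m →L[ℝ] Stack n m where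
  toFun θ := G.avL m θ
  map_add' θ θ' := by
    ext1 z
    rw [_root_.add_apply, avL_apply, avL_apply, avL_apply, ← app_T, ← app_T, ← app_T, app, map_add]
  map_smul' c θ := by
    ext1 z
    rw [_root_.smul_apply, avL_apply, avL_apply, ← app_T, ← app_T, app, map_smul]; rfl

theorem exists_norm_avL_le (m : ℕ) : ∃ a ≥ (0 : ℝ), ∀ θ : Params l, ‖G.avL m θ‖ ≤ a * ‖θ‖ :=
  ⟨_, norm_nonneg _, fun θ => (G.avLin m).toContinuousLinearMap.le_opNorm θ⟩

theorem avL_rot (θ : Params l) (R : Matrix (Fin m) (Fin m) ℝ) (z : Stack l m) :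
    G.avL m θ (rot R z) = rot R (G.avL m θ z) := app_bar_rot _ _ _

theorem relL_rot (R : Matrix (Fin m) (Fin m) ℝ) (p : Stack n m) :
    G.relL m (rot R p) = rot R (G.relL m p) := G.rel_rot R p

/-- Membership in the region of attraction gives closeness to the shape set, if closeness
self-improves in `𝒬`. -/
theorem infDist_le_of_mem_region {zs : Stack l m} {ρ ε δ : ℝ} {θ : Params l} (hδ : 0 < δ)
    (himp : ∀ p : Stack n m, Metric.infDist (G.relL m p) (shapeSet zs) ≤ δ →
      (ε + 1) / 4 * ‖quadError (lenForm l m) (lenForm l m zs zs) (G.relL m p)‖ ^ 2 ≤ ρ →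
      Metric.infDist (G.relL m p) (shapeSet zs) ≤ δ / 2)
    {x : Stack n m × Stack n m} (hx : x ∈ G.region zs ρ ε 1 1 θ) :
    Metric.infDist (G.relL m x.1) (shapeSet zs) ≤ δ ∧
      (ε + 1) / 4 * ‖quadError (lenForm l m) (lenForm l m zs zs) (G.relL m x.1)‖ ^ 2
        + 1 / 2 * ‖velErr (G.relL m) (G.avL m θ) x.1 x.2‖ ^ 2 ≤ ρ := by
  obtain ⟨y, hy, -, σ, hσ⟩ := hx
  have hQ : ∀ t, (ε + 1) / 4 * ‖quadError (lenForm l m) (lenForm l m zs zs) (G.relL m (σ t).1)‖ ^ 2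
        + 1 / 2 * ‖velErr (G.relL m) (G.avL m θ) (σ t).1 (σ t).2‖ ^ 2 ≤ ρ := fun t => by
    have h := hσ t
    simp only [statesQ, setQ, Set.mem_ofPred_eq, mul_one, distError_eq, velError_eq] at h
    exact h
  constructor
  · have hcont : Continuous fun t => Metric.infDist (G.relL m (σ.extend t).1) (shapeSet zs) :=
      (Metric.continuous_infDist_pt _).comp
        ((G.relL m).continuous.comp (continuous_fst.comp σ.continuous_extend))
    -- The joining path starts on the shape set and stays in 𝒬, where the distance cannot cross from
    -- δ/2 to δ; this excludes other realizations with the same lengths.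
    have h := le_of_bootstrap (g := fun t => Metric.infDist (G.relL m (σ.extend t).1) (shapeSet zs))
      (T := 1) (half_lt_self hδ) hcont.continuousOn (by
        rw [Path.extend_zero, relL_apply, Metric.infDist_zero_of_mem hy]; exact hδ.le)
      (fun t ht hs => by
        refine himp _ (hs t ⟨ht.1, le_rfl⟩) ?_
        rw [Path.extend_apply σ ht]
        have := hQ ⟨t, ht⟩
        have h2 : 0 ≤ 1 / 2 * ‖velErr (G.relL m) (G.avL m θ) (σ ⟨t, ht⟩).1 (σ ⟨t, ht⟩).2‖ ^ 2 := by
          positivity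
        linarith) 1 ⟨zero_le_one, le_rfl⟩
    simp only [Path.extend_one] at h
    linarith
  · have := hQ 1
    rwa [σ.target] at this

end SensingGraph

end Formation

/-! ### Assembly of the theorem -/

open Formation in
theorem theorem4 {n l m : ℕ} (hn : 2 ≤ n) (hm : m = 2 ∨ m = 3)
    (G : Formation.SensingGraph n l) (ps : Formation.Stack n m) (hG : G.InfMinRigid ps) :
    ∃ ρ > (0 : ℝ), ∃ ρμ > (0 : ℝ), ∃ ε > (0 : ℝ), ∃ c₁ > (0 : ℝ), ∃ c₂ > (0 : ℝ),
      ∀ θ : Formation.Params l, G.IsDesigned (G.rel ps) θ → ‖θ‖ ≤ ρμ →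
        G.ErrorExpStableOn (G.rel ps) c₁ c₂ θ (G.region (G.rel ps) ρ ε c₁ c₂ θ) ∧
        ∀ p v : ℝ → Formation.Stack n m, G.IsSolution (G.rel ps) c₁ c₂ θ p v →
          (p 0, v 0) ∈ G.region (G.rel ps) ρ ε c₁ c₂ θ →
          G.ConvergesToMotion (G.rel ps) θ p v := by
  obtain ⟨δ, hδ, C, hC, hnear⟩ := hG.exists_near hn
  obtain ⟨c, hc, hcoer⟩ := hG.exists_coercive
  obtain ⟨ρ, hρ, ν, hν, ε, hε, γ, hγ, hPν, himp, hdecay⟩ :=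
    exists_uniform_decay lenForm_comm hδ hC hc hnear hcoer
      (fun z hz => (norm_of_mem_shapeSet hz).le) (norm_nonneg _)
  obtain ⟨a, ha, hav⟩ := G.exists_norm_avL_le m
  -- Unit gains suffice. The bound on θ ensures ‖N‖ ≤ ν, with a + 1 avoiding a division by zero.
  refine ⟨ρ, hρ, ν / (a + 1), by positivity, ε, hε, 1, one_pos, 1, one_pos, fun θ hθ hθν => ?_⟩
  set zs := G.rel ps
  set P := G.relL m
  set β := lenForm l m
  set N := G.avL m θ
  have hNν : ‖N‖ ≤ ν := (hav θ).trans (by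
    calc a * ‖θ‖ ≤ (a + 1) * (ν / (a + 1)) := by gcongr; linarith
      _ = ν := by field_simp)
  have htan0 : β zs (P (N zs)) = 0 := G.isDesigned_tangent hθ
  have htan : ∀ z ∈ shapeSet zs, β z (P (N z)) = 0 := by
    intro z hz
    obtain ⟨R, hR, rfl⟩ := exists_of_mem_shapeSet hz
    rw [G.avL_rot, G.relL_rot, lenForm_rot (transpose_mul_self_of_mem_SO hR)]
    exact htan0
  have hreg := fun {x} => G.infDist_le_of_mem_region (θ := θ) (x := x) hδ himp
  have herr : ∀ T, ∀ p v : ℝ → Stack n m, IsSol P β (β zs zs) N (Set.Icc 0 T) p v →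
      (p 0, v 0) ∈ G.region zs ρ ε 1 1 θ → ∀ t ∈ Set.Icc 0 T,
      Metric.infDist (P (p t)) (shapeSet zs) ≤ δ ∧
        ‖quadError β (β zs zs) (P (p t))‖ + ‖velErr P N (p t) (v t)‖ ≤
          5 * Real.exp (-γ * t) *
            (‖quadError β (β zs zs) (P (p 0))‖ + ‖velErr P N (p 0) (v 0)‖) :=
    fun T p v hsol h0 => hdecay N hNν htan T p v hsol (hreg h0).1 (hreg h0).2
  have hglob : ∀ p v : ℝ → Stack n m, IsSol P β (β zs zs) N (Set.Ici 0) p v →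
      (p 0, v 0) ∈ G.region zs ρ ε 1 1 θ → ∀ t, 0 ≤ t →
      Metric.infDist (P (p t)) (shapeSet zs) ≤ δ ∧
        ‖quadError β (β zs zs) (P (p t))‖ + ‖velErr P N (p t) (v t)‖ ≤
          5 * Real.exp (-γ * t) *
            (‖quadError β (β zs zs) (P (p 0))‖ + ‖velErr P N (p 0) (v 0)‖) :=
    fun p v hsol h0 t ht => herr t p v (hsol.mono Set.Icc_subset_Ici_self) h0 t ⟨ht, le_rfl⟩
  refine ⟨⟨?_, 5, by norm_num, γ, hγ, ?_⟩, ?_⟩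
  · rintro ⟨p₀, v₀⟩ hx
    set Δ := 5 * (‖quadError β (β zs zs) (P p₀)‖ + ‖velErr P N p₀ v₀‖)
    have hΔ : 0 ≤ Δ := by positivity
    set r := ‖zs‖ + C * Δ
    have hr : 0 ≤ r := by positivity
    -- On any existence interval ‖P p‖ ≤ r by the error bound, and v = w + N P p gives ‖v‖ ≤ Δ + ‖N‖
    -- r.
    obtain ⟨p, v, hsol, hp0, hv0⟩ := exists_isSol_Ici (P := P) (β := β) (e₀ := β zs zs) (N := N)
      p₀ v₀ (r + Δ + ‖N‖ * r) (fun T hT p v hsol hp0 hv0 => by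
        subst hp0 hv0
        obtain ⟨h1, h2⟩ := herr T p v hsol hx T ⟨hT, le_rfl⟩
        have h3 : ‖quadError β (β zs zs) (P (p T))‖ + ‖velErr P N (p T) (v T)‖ ≤ Δ := by
          refine h2.trans ?_
          rw [mul_assoc, mul_left_comm]
          exact mul_le_of_le_one_left hΔ (Real.exp_le_one_iff.2 (by nlinarith))
        have he0 := norm_nonneg (quadError β (β zs zs) (P (p T)))
        have hw0 := norm_nonneg (velErr P N (p T) (v T))
        obtain ⟨z, hz, hz'⟩ := hnear (p T) h1
        have hPr : ‖P (p T)‖ ≤ r := by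
          have h4 : ‖P (p T)‖ ≤ ‖z‖ + ‖P (p T) - z‖ := norm_le_norm_add_norm_sub' _ _
          have h5 : ‖P (p T) - z‖ ≤ C * Δ := hz'.trans (by gcongr; linarith)
          rw [norm_of_mem_shapeSet hz] at h4
          linarith
        have hNr : ‖N (P (p T))‖ ≤ ‖N‖ * r := (N.le_opNorm _).trans (by gcongr)
        have hvw : ‖v T‖ ≤ ‖velErr P N (p T) (v T)‖ + ‖N (P (p T))‖ := by
          have : v T = velErr P N (p T) (v T) + N (P (p T)) := by simp [velErr]
          conv_lhs => rw [this]
          exact norm_add_le _ _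
        have hNr0 : 0 ≤ ‖N‖ * r := by positivity
        exact ⟨by linarith, by linarith⟩)
    exact ⟨p, v, (G.isSolution_iff zs θ p v).2 hsol, hp0, hv0⟩
  · intro p v hsol h0 t ht
    simp only [distError_eq, G.velError_eq]
    exact (hglob p v ((G.isSolution_iff zs θ p v).1 hsol) h0 t ht).2
  · intro p v hsol h0
    replace hsol := (G.isSolution_iff zs θ p v).1 hsol
    obtain ⟨W, hW, hPW⟩ := hG.exists_skew hn (p := N zs) htan0
    set M := P.comp N
    have hMrot : ∀ R (x : Stack l m), M (rot R x) = rot R (M x) := fun R x => by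
      change P (N (rot R x)) = rot R (P (N x))
      rw [G.avL_rot, G.relL_rot]
    set Δ := 5 * (‖quadError β (β zs zs) (P (p 0))‖ + ‖velErr P N (p 0) (v 0)‖)
    have hΔ : 0 ≤ Δ := by positivity
    have hM : 2 * ‖M‖ < γ := by
      have : ‖M‖ ≤ ‖P‖ * ν := (ContinuousLinearMap.opNorm_comp_le _ _).trans (by gcongr)
      linarith
    have hsum : ∀ t, 0 ≤ t →
        ‖quadError β (β zs zs) (P (p t))‖ + ‖velErr P N (p t) (v t)‖ ≤ Δ * Real.exp (-γ * t) :=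
      fun t ht => (hglob p v hsol h0 t ht).2.trans_eq (by ring)
    have hexp := fun t : ℝ => (Real.exp_pos (-γ * t)).le
    have hw : ∀ t, 0 ≤ t → ‖velErr P N (p t) (v t)‖ ≤ Δ * Real.exp (-γ * t) := fun t ht => by
      linarith [hsum t ht, norm_nonneg (quadError β (β zs zs) (P (p t)))]
    have he : ∀ t, 0 ≤ t → ‖quadError β (β zs zs) (P (p t))‖ ≤ Δ * Real.exp (-γ * t) :=
      fun t ht => by linarith [hsum t ht, norm_nonneg (velErr P N (p t) (v t))]
    obtain ⟨y, hy, hlim⟩ := exists_asymptotic_orbit (Z := shapeSet zs) (M := M)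
      (D := (‖P‖ + C) * Δ) (γ := γ) (z := fun t => P (p t)) (d := fun t => P (velErr P N (p t) (v t)))
      (isCompact_shapeSet zs).isClosed (by positivity) hγ hM
      (fun t x hx => exp_mem_shapeSet hMrot hW hPW t hx)
      (fun t ht => (hasDerivWithinAt_rel hsol ht).congr_deriv (add_comm _ _))
      (fun t ht => by
        calc ‖P (velErr P N (p t) (v t))‖ ≤ ‖P‖ * (Δ * Real.exp (-γ * t)) :=
              (P.le_opNorm _).trans (by gcongr; exact hw t ht)
          _ ≤ (‖P‖ + C) * (Δ * Real.exp (-γ * t)) := by gcongr; linarith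
          _ = _ := by ring)
      (fun t ht => by
        obtain ⟨z, hz, hz'⟩ := hnear (p t) (hglob p v hsol h0 t ht).1
        refine ⟨z, hz, hz'.trans ?_⟩
        calc C * ‖quadError β (β zs zs) (P (p t))‖ ≤ C * (Δ * Real.exp (-γ * t)) := by
              gcongr; exact he t ht
          _ ≤ (‖P‖ + C) * (Δ * Real.exp (-γ * t)) := by gcongr; linarith [norm_nonneg P]
          _ = _ := by ring)
    refine ⟨fun t => NormedSpace.exp (t • M) y, fun t _ =>
      ⟨exp_mem_shapeSet hMrot hW hPW t hy, (hasDerivAt_exp_smul_apply M y t).hasDerivWithinAt⟩,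
      hlim, ?_⟩
    have hw0 : Tendsto (fun t => velErr P N (p t) (v t)) atTop (nhds 0) := by
      rw [tendsto_zero_iff_norm_tendsto_zero]
      refine squeeze_zero' (Eventually.of_forall fun _ => norm_nonneg _) ?_
        (tendsto_const_mul_exp_neg (D := Δ) hγ)
      filter_upwards [eventually_ge_atTop 0] with t ht using hw t ht
    -- The velocity deviation is w + N(z - z*), and both summands tend to zero.
    have hN0 := (N.continuous.tendsto 0).comp hlim
    rw [map_zero] at hN0
    have := hw0.add hN0
    rw [add_zero] at this
    refine this.congr fun t => ?_
    simp only [Function.comp_apply, map_sub, velErr]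
    exact sub_add_sub_cancel _ _ _
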